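/- Let $S_{\mathbb Z}$ be the group of permutations of $\mathbb Z$ fixing all but finitely many points, $\ell(w)$ the number of pairs $i<j$ with $w(i)>w(j)$, and $\mathcal I_{\mathbb Z}=\{y\in S_{\mathbb Z}: y=y^{-1}\}$. Let $<$ be the Bruhat order on $S_{\mathbb Z}$ (the transitive closure of the relations $w<wt$ with $t$ a transposition and $\ell(w)<\ell(wt)$), and write $u\lessdot v$ if $\{\sigma\in S_{\mathbb Z}: u\le\sigma<v\}=\{u\}$. Let $\circ$ be the Demazure product: the unique associative map $S_{\mathbb Z}\times S_{\mathbb Z}\to S_{\mathbb Z}$ with $u\circ v=uv$ if $\ell(uv)=\ell(u)+\ell(v)$ and $s\circ s=s$ for all $s=(i,i+1)$. For $y\in\mathcal I_{\mathbb Z}$ let $\mathcal A(y)$, the set of atoms of $y$, be the set of $w\in S_{\mathbb Z}$ of minimal length with $y=w^{-1}\circ w$. For $y\in\mathcal I_{\mathbb Z}$ and integers $i<j$, let $A=\{i,j,y(i),y(j)\}$, and let $a<b<\cdots$ be the elements of $A$ in increasing order. Define $\tau_{ij}(y)\in S_{\mathbb Z}$ to agree with $y$ outside $A$ and to have on $A$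 the following cycles (fixed points omitted): - if $y|_A=1$, $A=\{a<b\}$ and $(i,j)=(a,b)$: $(a,b)$; - if $A=\{a<b<c\}$, $y|_A=(a,b)$ and $(i,j)\in\{(b,c),(a,c)\}$: $(a,c)$; - if $A=\{a<b<c\}$, $y|_A=(b,c)$ and $(i,j)\in\{(a,b),(a,c)\}$: $(a,c)$; - if $A=\{a<b<c<d\}$, $y|_A=(a,b)(c,d)$ and $(i,j)=(b,c)$: $(a,c)(b,d)$; - if $A=\{a<b<c<d\}$, $y|_A=(a,b)(c,d)$ and $(i,j)\in\{(a,c),(b,d),(a,d)\}$: $(a,d)$; - if $A=\{a<b<c<d\}$, $y|_A=(a,c)(b,d)$ and $(i,j)\in\{(a,b),(c,d),(a,d)\}$: $(a,d)(b,c)$; - in all other cases $\tau_{ij}(y)=y$. **Theorem.** (1) Let $y\in\mathcal I_{\mathbb Z}$ and $w\in\mathcal A(y)$, and let $i<j$ be integers such that $w\lessdot w(i,j)$. (a) If $w(i,j)\in\mathcal A(z)$ for some $z\in\mathcal I_{\mathbb Z}$, then $z=\tau_{ij}(y)\ne y$. (b) If $w(i,j)\notin\mathcal A(z)$ for all $z\in\mathcal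 I_{\mathbb Z}$, then $\tau_{ij}(y)=y$. (2) Let $i<j$ be integers, $t=(i,j)$ and $y\in\mathcal I_{\mathbb Z}$. There is at most one $z\in\mathcal I_{\mathbb Z}$ for which some $w\in\mathcal A(y)$ satisfies $w\lessdot wt\in\mathcal A(z)$. In particular, there is at most one $z\in\mathcal I_{\mathbb Z}$ such that $\varnothing\ne\{wt : wt\lessdot w\in\mathcal A(z)\}\subset\mathcal A(y)$. -/

import Mathlib

namespace InvolutionAtoms

/-- The group of permutations of the integers that fix all but finitely many points. -/
def SZ : Subgroup (Equiv.Perm ℤ) where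
  carrier := {w | {i : ℤ | w i ≠ i}.Finite}
  one_mem' := by simp
  mul_mem' := by
    intro a b ha hb
    refine (Set.Finite.union ha hb).subset ?_
    intro i hi
    by_contra h
    simp only [Set.mem_union, Set.mem_ofPred_eq, not_or, not_not] at h
    exact hi (by simp [h.1, h.2])
  inv_mem' := by
    intro a ha
    refine Set.Finite.subset ha ?_
    intro i hi h
    exact hi (by rw [Equiv.Perm.inv_eq_iff_eq]; exact h.symm)

/-- The transposition `(i,j)` (the identity when `i = j`). -/
def tr (i j : ℤ) : SZ :=
  ⟨Equiv.swap i j, by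
    refine (Set.toFinite ({i, j} : Set ℤ)).subset ?_
    intro k hk
    by_contra h
    simp only [Set.mem_insert_iff, Set.mem_singleton_iff, not_or] at h
    exact hk (Equiv.swap_apply_of_ne_of_ne h.1 h.2)⟩

/-- The inversion set of `w`. -/
def Inv (w : SZ) : Set (ℤ × ℤ) := {p | p.1 < p.2 ∧ w.1 p.2 < w.1 p.1}

/-- The length of `w`: its number of inversions (a finite number, see `finite_Inv`). -/
noncomputable def len (w : SZ) : ℕ := (Inv w).ncard

/-- The simple transposition `(i,i+1)`. -/
def simple (i : ℤ) : SZ := tr i (i + 1)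

/-- The Bruhat order, strict version: the transitive closure of the relations `u < u t` with `t` a
transposition such that `ℓ(u) < ℓ(u t)`. -/
def BruhatLT : SZ → SZ → Prop :=
  Relation.TransGen fun u v => ∃ i j : ℤ, i ≠ j ∧ v = u * tr i j ∧ len u < len v

/-- The Bruhat order. -/
def BruhatLE (u v : SZ) : Prop := u = v ∨ BruhatLT u v

/-- `v` covers `u` in the Bruhat order: the only `σ` with `u ≤ σ < v` is `u`. -/
def Covers (u v : SZ) : Prop := {σ : SZ | BruhatLE u σ ∧ BruhatLT σ v} = {u}

/-- The properties that characterize the Demazure product. -/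
structure IsDemazureProduct (f : SZ → SZ → SZ) : Prop where
  assoc : ∀ u v w, f (f u v) w = f u (f v w)
  mul : ∀ u v, len (u * v) = len u + len v → f u v = u * v
  idem : ∀ i : ℤ, f (simple i) (simple i) = simple i

/-! ### Existence and uniqueness of the Demazure product -/

theorem finite_Inv (w : SZ) : (Inv w).Finite := by
  obtain ⟨M, hM⟩ := (w.2 : {i : ℤ | w.1 i ≠ i}.Finite).bddAbove
  obtain ⟨m, hm⟩ := (w.2 : {i : ℤ | w.1 i ≠ i}.Finite).bddBelow
  have key : ∀ i, w.1 i = i ∨ (m ≤ i ∧ i ≤ M ∧ m ≤ w.1 i ∧ w.1 i ≤ M) := by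
    intro i
    by_cases h : w.1 i = i
    · exact Or.inl h
    · have h2 : w.1 (w.1 i) ≠ w.1 i := fun e => h (w.1.injective e)
      exact Or.inr ⟨hm h, hM h, hm h2, hM h2⟩
  refine ((Set.finite_Icc m M).prod (Set.finite_Icc m M)).subset ?_
  rintro ⟨i, j⟩ ⟨h1, h2⟩
  simp only at h1 h2
  simp only [Set.mem_prod, Set.mem_Icc]
  rcases key i with hi | hi <;> rcases key j with hj | hj <;> omega

theorem simple_apply (i a : ℤ) :
    (simple i).1 a = if a = i then i + 1 else if a = i + 1 then i else a :=
  Equiv.swap_apply_def i (i + 1) a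

theorem simple_mul_self (i : ℤ) : simple i * simple i = 1 := by
  apply Subtype.ext
  exact Equiv.swap_mul_self i (i + 1)

theorem simple_inv (i : ℤ) : (simple i)⁻¹ = simple i :=
  inv_eq_of_mul_eq_one_left (simple_mul_self i)

theorem mul_apply (u v : SZ) (a : ℤ) : (u * v).1 a = u.1 (v.1 a) := rfl

theorem len_one : len 1 = 0 := by
  have : Inv 1 = ∅ := by
    ext ⟨a, b⟩
    simp [Inv]
    intro h
    exact h.le
  simp [len, this]

theorem len_mul_simple (w : SZ) (i : ℤ) (h : w.1 i < w.1 (i + 1)) :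
    len (w * simple i) = len w + 1 := by
  have hinj : Function.Injective
      (fun p : ℤ × ℤ => ((simple i).1 p.1, (simple i).1 p.2)) := by
    rintro ⟨a, b⟩ ⟨c, d⟩ hp
    simp only [Prod.mk.injEq] at hp
    exact Prod.ext ((simple i).1.injective hp.1) ((simple i).1.injective hp.2)
  have hss : ∀ a, (simple i).1 ((simple i).1 a) = a := by
    intro a
    rw [← mul_apply, simple_mul_self]; rfl
  have hI : Inv (w * simple i) = insert (i, i + 1)
      ((fun p : ℤ × ℤ => ((simple i).1 p.1, (simple i).1 p.2)) '' Inv w) := by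
    ext ⟨a, b⟩
    simp only [Inv, Set.mem_ofPred_eq, Set.mem_insert_iff, Set.mem_image, Prod.mk.injEq, mul_apply,
      Prod.exists]
    constructor
    · rintro ⟨h1, h2⟩
      by_cases hc : a = i ∧ b = i + 1
      · exact Or.inl hc
      · refine Or.inr ⟨(simple i).1 a, (simple i).1 b, ⟨?_, h2⟩, hss a, hss b⟩
        rw [simple_apply, simple_apply]
        split_ifs <;> omega
    · rintro (⟨rfl, rfl⟩ | ⟨c, d, ⟨h1, h2⟩, rfl, rfl⟩)
      · refine ⟨by omega, ?_⟩
        have e1 : (simple a).1 a = a + 1 := by simp [simple_apply]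
        have e2 : (simple a).1 (a + 1) = a := by simp [simple_apply]
        rw [e1, e2]; exact h
      · rw [hss, hss]
        refine ⟨?_, h2⟩
        have hc : ¬ (c = i ∧ d = i + 1) := by
          rintro ⟨rfl, rfl⟩
          exact absurd h2 (not_lt.mpr h.le)
        rw [simple_apply, simple_apply]
        split_ifs <;> omega
  have hn : (i, i + 1) ∉
      ((fun p : ℤ × ℤ => ((simple i).1 p.1, (simple i).1 p.2)) '' Inv w) := by
    rintro ⟨⟨c, d⟩, ⟨h1, h2⟩, he⟩
    simp only [Prod.mk.injEq, simple_apply] at he h1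
    obtain ⟨e1, e2⟩ := he
    split_ifs at e1 e2 <;> omega
  rw [len, hI, Set.ncard_insert_of_notMem hn ((finite_Inv w).image _),
    Set.ncard_image_of_injective _ hinj]
  rfl

theorem mul_simple_lt_iff (w : SZ) (i : ℤ) :
    (w * simple i).1 i < (w * simple i).1 (i + 1) ↔ w.1 (i + 1) < w.1 i := by
  have e1 : (simple i).1 i = i + 1 := by simp [simple_apply]
  have e2 : (simple i).1 (i + 1) = i := by simp [simple_apply]
  rw [mul_apply, mul_apply, e1, e2]

theorem lt_or_gt (w : SZ) (i : ℤ) : w.1 i < w.1 (i + 1) ∨ w.1 (i + 1) < w.1 i :=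
  lt_or_gt_of_ne fun e => by have := w.1.injective e; omega

theorem len_mul_simple_of_gt (w : SZ) (i : ℤ) (h : w.1 (i + 1) < w.1 i) :
    len w = len (w * simple i) + 1 := by
  have := len_mul_simple (w * simple i) i ((mul_simple_lt_iff w i).2 h)
  rwa [mul_assoc, simple_mul_self, mul_one] at this

theorem exists_descent (w : SZ) (hw : w ≠ 1) : ∃ i, w.1 (i + 1) < w.1 i := by
  by_contra hc
  push Not at hc
  apply hw
  obtain ⟨M, hM⟩ := (w.2 : {i : ℤ | w.1 i ≠ i}.Finite).bddAbove
  obtain ⟨m, hm⟩ := (w.2 : {i : ℤ | w.1 i ≠ i}.Finite).bddBelow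
  have hmono : Monotone (fun i => w.1 i - i) := by
    apply monotone_int_of_le_succ
    intro i
    rcases lt_or_gt w i with h | h
    · omega
    · exact absurd h (not_lt.mpr (hc i))
  apply Subtype.ext
  ext i
  by_contra hi
  have hi' : w.1 i ≠ i := hi
  have h1 : w.1 (M + 1) = M + 1 := by
    by_contra h; have := hM h; omega
  have h2 : w.1 (m - 1) = m - 1 := by
    by_contra h; have := hm h; omega
  have h3 := hmono (show m - 1 ≤ i by have := hm hi'; omega)
  have h4 := hmono (show i ≤ M + 1 by have := hM hi'; omega)
  simp only at h3 h4
  omega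

/-- Induction on reduced expressions. -/
theorem right_induction {P : SZ → Prop} (one : P 1)
    (step : ∀ v i, v.1 i < v.1 (i + 1) → P v → P (v * simple i)) (w : SZ) : P w := by
  induction hn : len w using Nat.strong_induction_on generalizing w with
  | _ n ih =>
    by_cases hw : w = 1
    · exact hw ▸ one
    · obtain ⟨i, hi⟩ := exists_descent w hw
      have h1 := len_mul_simple_of_gt w i hi
      have h2 := step (w * simple i) i ((mul_simple_lt_iff w i).2 hi)
        (ih _ (by omega) _ rfl)
      rwa [mul_assoc, simple_mul_self, mul_one] at h2

theorem len_mul_simple_le (w : SZ) (i : ℤ) : len (w * simple i) ≤ len w + 1 := by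
  rcases lt_or_gt w i with h | h
  · exact (len_mul_simple w i h).le
  · have := len_mul_simple_of_gt w i h
    omega

theorem len_mul_le (u v : SZ) : len (u * v) ≤ len u + len v := by
  induction v using right_induction with
  | one => simp
  | step v i h ih =>
    have h1 := len_mul_simple_le (u * v) i
    have h2 := len_mul_simple v i h
    rw [mul_assoc] at h1
    omega

/-- The Demazure action of a simple transposition from the right. -/
def rop (i : ℤ) (w : SZ) : SZ := if w.1 i < w.1 (i + 1) then w * simple i else w

/-- The Demazure action of a simple transposition from the left. -/
def lop (i : ℤ) (w : SZ) : SZ := (rop i w⁻¹)⁻¹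

theorem lop_eq (i : ℤ) (w : SZ) :
    lop i w = if w.1⁻¹ i < w.1⁻¹ (i + 1) then simple i * w else w := by
  unfold lop rop
  by_cases h : w.1⁻¹ i < w.1⁻¹ (i + 1)
  · have h' : (w⁻¹).1 i < (w⁻¹).1 (i + 1) := h
    rw [if_pos h, if_pos h', mul_inv_rev, inv_inv, simple_inv]
  · have h' : ¬ (w⁻¹).1 i < (w⁻¹).1 (i + 1) := h
    rw [if_neg h, if_neg h', inv_inv]

theorem lop_rop (i j : ℤ) (w : SZ) : lop i (rop j w) = rop j (lop i w) := by
  by_cases h1 : w.1 j = i ∧ w.1 (j + 1) = i + 1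
  · obtain ⟨ha, hb⟩ := h1
    have hc : simple i * w = w * simple j := by
      apply Subtype.ext
      have := Equiv.mul_swap_eq_swap_mul w.1 j (j + 1)
      rw [ha, hb] at this
      exact this.symm
    have ia : w.1⁻¹ i = j := by rw [Equiv.Perm.inv_eq_iff_eq, ha]
    have ib : w.1⁻¹ (i + 1) = j + 1 := by rw [Equiv.Perm.inv_eq_iff_eq, hb]
    have e1 : rop j w = w * simple j := if_pos (by omega)
    have e2 : lop i w = simple i * w := by rw [lop_eq, if_pos (by omega)]
    rw [e1, e2, lop_eq, if_neg, hc, rop, if_neg]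
    · rw [mul_simple_lt_iff]; omega
    · have h3 : ((w * simple j).1)⁻¹ = (simple j).1 * w.1⁻¹ := by
        have := simple_inv j
        have h4 : ((w * simple j)⁻¹).1 = (simple j * w⁻¹).1 := by rw [mul_inv_rev, simple_inv]
        exact h4
      rw [h3, Equiv.Perm.mul_apply, Equiv.Perm.mul_apply, ia, ib, simple_apply, simple_apply]
      simp
  · by_cases h2 : w.1 j = i + 1 ∧ w.1 (j + 1) = i
    · obtain ⟨ha, hb⟩ := h2
      have ia : w.1⁻¹ i = j + 1 := by rw [Equiv.Perm.inv_eq_iff_eq, hb]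
      have ib : w.1⁻¹ (i + 1) = j := by rw [Equiv.Perm.inv_eq_iff_eq, ha]
      have e1 : rop j w = w := if_neg (by omega)
      have e2 : lop i w = w := by rw [lop_eq, if_neg (by omega)]
      rw [e1, e2, e1]
    · have k1 : (simple i * w).1 j < (simple i * w).1 (j + 1) ↔ w.1 j < w.1 (j + 1) := by
        have hne : w.1 j ≠ w.1 (j + 1) := fun e => by have := w.1.injective e; omega
        rw [mul_apply, mul_apply, simple_apply, simple_apply]
        split_ifs <;> omega
      have h3 : ((w * simple j).1)⁻¹ = (simple j).1 * w.1⁻¹ := by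
        have h4 : ((w * simple j)⁻¹).1 = (simple j * w⁻¹).1 := by rw [mul_inv_rev, simple_inv]
        exact h4
      have k2 : ((w * simple j).1)⁻¹ i < ((w * simple j).1)⁻¹ (i + 1) ↔
          w.1⁻¹ i < w.1⁻¹ (i + 1) := by
        have hne : w.1⁻¹ i ≠ w.1⁻¹ (i + 1) := fun e => by
          have := w.1⁻¹.injective e; omega
        have g1 : ¬ (w.1⁻¹ i = j ∧ w.1⁻¹ (i + 1) = j + 1) := by
          rw [Equiv.Perm.inv_eq_iff_eq, Equiv.Perm.inv_eq_iff_eq]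
          rintro ⟨a, b⟩; exact h1 ⟨a.symm, b.symm⟩
        have g2 : ¬ (w.1⁻¹ i = j + 1 ∧ w.1⁻¹ (i + 1) = j) := by
          rw [Equiv.Perm.inv_eq_iff_eq, Equiv.Perm.inv_eq_iff_eq]
          rintro ⟨a, b⟩; exact h2 ⟨b.symm, a.symm⟩
        rw [h3, Equiv.Perm.mul_apply, Equiv.Perm.mul_apply, simple_apply, simple_apply]
        split_ifs <;> omega
      rw [lop_eq, lop_eq, rop, rop]
      by_cases c1 : w.1 j < w.1 (j + 1) <;> by_cases c2 : w.1⁻¹ i < w.1⁻¹ (i + 1)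
      · rw [if_pos c1, if_pos (k2.2 c2), if_pos c2, if_pos (k1.2 c1), mul_assoc]
      · rw [if_pos c1, if_neg (mt k2.1 c2), if_neg c2, if_pos c1]
      · rw [if_neg c1, if_pos c2, if_neg (mt k1.1 c1)]
      · rw [if_neg c1, if_neg c2, if_neg c1]

/-- The Demazure action of a word from the right. -/
def rfold (l : List ℤ) (u : SZ) : SZ := l.foldl (fun x i => rop i x) u

theorem rfold_concat (l : List ℤ) (i : ℤ) (u : SZ) :
    rfold (l ++ [i]) u = rop i (rfold l u) := by
  simp [rfold, List.foldl_append]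

theorem rfold_append (l m : List ℤ) (u : SZ) : rfold (l ++ m) u = rfold m (rfold l u) := by
  simp [rfold, List.foldl_append]

theorem exists_word (v : SZ) : ∃ l, rfold l 1 = v := by
  induction v using right_induction with
  | one => exact ⟨[], rfl⟩
  | step v i h ih =>
    obtain ⟨l, hl⟩ := ih
    exact ⟨l ++ [i], by rw [rfold_concat, hl, rop, if_pos h]⟩

theorem rfold_lop (l : List ℤ) (i : ℤ) (u : SZ) : rfold l (lop i u) = lop i (rfold l u) := by
  induction l using List.reverseRecOn with
  | nil => rfl
  | append_singleton l j ih => rw [rfold_concat, rfold_concat, ih, lop_rop]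

theorem left_induction {P : SZ → Prop} (one : P 1) (step : ∀ v i, P v → P (lop i v)) (w : SZ) :
    P w := by
  have h : ∀ w : SZ, P w⁻¹ := by
    intro w
    induction w using right_induction with
    | one => simpa using one
    | step v i h ih =>
      have h2 := step _ i ih
      rwa [lop, inv_inv, rop, if_pos h] at h2
  simpa using h w⁻¹

theorem rfold_congr {l m : List ℤ} (h : rfold l 1 = rfold m 1) (u : SZ) :
    rfold l u = rfold m u := by
  induction u using left_induction with
  | one => exact h
  | step v i ih => rw [rfold_lop, rfold_lop, ih]

theorem isDemazureProduct_rfold :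
    IsDemazureProduct fun u v => rfold (exists_word v).choose u where
  assoc u v w := by
    rw [← rfold_append]
    apply rfold_congr
    rw [rfold_append, (exists_word v).choose_spec]
    exact (exists_word (rfold (exists_word w).choose v)).choose_spec.symm
  mul u v := by
    induction v using right_induction with
    | one =>
      intro _
      rw [mul_one]
      exact rfold_congr (m := []) (exists_word 1).choose_spec u
    | step v i h ih =>
      intro hl
      have h1 := len_mul_simple v i h
      have h2 := len_mul_le u v
      have h3 := len_mul_simple_le (u * v) i
      rw [← mul_assoc] at hl ⊢
      have hasc : (u * v).1 i < (u * v).1 (i + 1) := by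
        rcases lt_or_gt (u * v) i with h | h
        · exact h
        · have := len_mul_simple_of_gt _ _ h
          omega
      have h4 : rfold (exists_word (v * simple i)).choose u =
          rfold ((exists_word v).choose ++ [i]) u := by
        apply rfold_congr
        rw [(exists_word (v * simple i)).choose_spec, rfold_concat,
          (exists_word v).choose_spec, rop, if_pos h]
      rw [h4, rfold_concat, ih (by omega), rop, if_pos hasc]
  idem i := by
    have e1 : (simple i).1 i = i + 1 := by simp [simple_apply]
    have e2 : (simple i).1 (i + 1) = i := by simp [simple_apply]
    have h1 : rfold (exists_word (simple i)).choose (simple i) = rfold [i] (simple i) := by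
      apply rfold_congr
      rw [(exists_word (simple i)).choose_spec]
      change _ = rop i 1
      rw [rop, if_pos, one_mul]
      change i < i + 1
      omega
    rw [h1]
    change rop i (simple i) = _
    rw [rop, if_neg]
    rw [e1, e2]; omega

theorem IsDemazureProduct.apply_simple {f : SZ → SZ → SZ} (hf : IsDemazureProduct f) (u : SZ)
    (i : ℤ) : f u (simple i) = rop i u := by
  have hs : len (simple i) = 1 := by
    have := len_mul_simple 1 i (by change i < i + 1; omega)
    rwa [one_mul, len_one] at this
  rcases lt_or_gt u i with h | h
  · rw [rop, if_pos h]
    exact hf.mul _ _ (by rw [hs, len_mul_simple u i h])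
  · rw [rop, if_neg (not_lt.mpr h.le)]
    have h1 : f (u * simple i) (simple i) = u := by
      rw [hf.mul, mul_assoc, simple_mul_self, mul_one]
      rw [mul_assoc, simple_mul_self, mul_one, hs, len_mul_simple_of_gt u i h]
    calc f u (simple i) = f (f (u * simple i) (simple i)) (simple i) := by rw [h1]
      _ = u := by rw [hf.assoc, hf.idem, h1]

/-- There is exactly one Demazure product. -/
theorem existsUnique_isDemazureProduct : ∃! f, IsDemazureProduct f := by
  refine ⟨_, isDemazureProduct_rfold, ?_⟩
  have key : ∀ f g, IsDemazureProduct f → IsDemazureProduct g → f = g := by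
    intro f g hf hg
    funext u v
    induction v using right_induction with
    | one => rw [hf.mul _ _ (by simp [len_one]), hg.mul _ _ (by simp [len_one])]
    | step v i h ih =>
      have e1 : v * simple i = f v (simple i) := by rw [hf.apply_simple, rop, if_pos h]
      have e2 : v * simple i = g v (simple i) := by rw [hg.apply_simple, rop, if_pos h]
      calc f u (v * simple i) = f u (f v (simple i)) := by rw [← e1]
        _ = rop i (f u v) := by rw [← hf.assoc, hf.apply_simple]
        _ = rop i (g u v) := by rw [ih]
        _ = g u (g v (simple i)) := by rw [← hg.assoc, hg.apply_simple]
        _ = g u (v * simple i) := by rw [← e2]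
  intro f hf
  exact key _ _ hf isDemazureProduct_rfold

/-! ### Involutions, atoms and the covering transformations -/

/-- The Demazure product: the unique associative map with `u ∘ v = u v` whenever
`ℓ(u v) = ℓ(u) + ℓ(v)` and `s ∘ s = s` for all simple transpositions `s`. -/
noncomputable def demazure : SZ → SZ → SZ := existsUnique_isDemazureProduct.choose

theorem isDemazureProduct_demazure : IsDemazureProduct demazure :=
  existsUnique_isDemazureProduct.choose_spec.1

/-- The involutions (the identity included). -/
def IZ : Set SZ := {y | y⁻¹ = y}

/-- The atoms of `y`: the elements `w` of minimal length such that `y = w⁻¹ ∘ w`. -/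
def atoms (y : SZ) : Set SZ :=
  {w | y = demazure w⁻¹ w ∧ ∀ v : SZ, y = demazure v⁻¹ v → len w ≤ len v}

/-- The covering transformation `τ_{ij}` for `i < j`, evaluated at an involution `y`. With
`p = y(i)` and `q = y(j)`, it changes `y` on the set `A = {i, j, p, q}` only: the cycles of `y` in
`A` are removed and new ones are added. Listing the elements of `A` in increasing order as
`a < b < ⋯`, the rows are indexed by the cycles of `y` in `A` and by the position of `(i,j)`;
in all remaining cases `τ_{ij}(y) = y`. -/
def tau (i j : ℤ) (y : SZ) : SZ :=
  let p := y.1 i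
  let q := y.1 j
  -- no cycle becomes `(a,b)`, when `(i,j)` is `(a,b)`
  if p = i ∧ q = j then y * tr i j
  -- `(a,b)` and the fixed point `c` become `(a,c)`, when `(i,j)` is `(b,c)` or `(a,c)`
  else if p ≠ i ∧ q = j ∧ p < j then y * tr i p * tr (min i p) j
  -- the fixed point `a` and `(b,c)` become `(a,c)`, when `(i,j)` is `(a,b)` or `(a,c)`
  else if p = i ∧ q ≠ j ∧ i < q then y * tr j q * tr i (max j q)
  -- `(a,b)(c,d)` becomes `(a,c)(b,d)`, when `(i,j)` is `(b,c)`
  else if p < i ∧ i < j ∧ j < q then y * (tr p i * tr j q) * (tr p j * tr i q)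
  -- `(a,b)(c,d)` becomes `(a,d)`, when `(i,j)` is `(a,c)`, `(b,d)` or `(a,d)`
  else if p ≠ i ∧ q ≠ j ∧ max i p < min j q then
    y * (tr i p * tr j q) * tr (min i p) (max j q)
  -- `(a,c)(b,d)` becomes `(a,d)(b,c)`, when `(i,j)` is `(a,b)`
  else if i < j ∧ j < p ∧ p < q then y * (tr i p * tr j q) * (tr i q * tr j p)
  -- `(a,c)(b,d)` becomes `(a,d)(b,c)`, when `(i,j)` is `(c,d)`
  else if p < q ∧ q < i ∧ i < j then y * (tr p i * tr q j) * (tr p j * tr q i)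
  -- `(a,c)(b,d)` becomes `(a,d)(b,c)`, when `(i,j)` is `(a,d)`
  else if i < q ∧ q < p ∧ p < j then y * (tr i p * tr q j) * (tr i j * tr q p)
  else y

end InvolutionAtoms

open InvolutionAtoms

namespace InvolutionAtoms

/-! Read `w` as a word in which the letter `x` stands at position `w x`, that is, as the one-line
notation of the inverse of `w`. The proof rests on a local description of atoms, `mem_atoms_iff`:
`w` is an atom of `y` iff, counting fixed points as cycles, each cycle of `y` has its larger letter
before its smaller one, and any two cycles are placed as follows. If neither encloses the other, the
one with the smaller endpoints wholly precedes the other; if one encloses the other, no letter of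
the inner cycle stands between the two letters of the outer one.

This description is carried along reduced words. Passing from `v` to a longer `v * simple k` changes
the involution by Demazure conjugation, which for atoms either creates the cycle `(k,k+1)` out of
two fixed points or relabels `k` and `k+1`; the local conditions survive both moves and their
inverses. A length formula depending only on `y` then shows that every word satisfying the
conditions has minimal length.

A Bruhat cover `w ⋖ w (i,j)` exchanges the letters `i < j`, where `i` stands before `j` and no
letter of intermediate value stands between them. Where `τ_{ij}` changes `y`, the new word satisfies
the conditions for the new involution by a finite comparison of orders. Where `τ_{ij}` fixes `y`,
the new word is an atom of no `z` at all (`Atomic.not_atomic_swap_right` and its mirror image): the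
inversions of the two words, read alternately with `y` and `z`, would produce infinitely many nested
intervals of positions (`Atomic.no_chain`).

Since an atom determines its involution as `w⁻¹ ∘ w`, this dichotomy gives every statement of the
theorem. -/

/-! ### The local conditions on a word -/

/-- The relative position, in the word whose letter `x` stands at position `W x`, that the cycles
`(p,q)` and `(p',q')` of an involution have when the word is the inverse of an atom. -/
def Cfg (W : ℤ → ℤ) (p q p' q' : ℤ) : Prop :=
  (p < p' ∧ q < q' ∧ W p < W q') ∨ (p' < p ∧ q' < q ∧ W p' < W q) ∨
  (p < p' ∧ q' < q ∧ (W p' < W q ∨ W p < W q' ∨ (W q' < W q ∧ W p < W p'))) ∨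
  (p' < p ∧ q < q' ∧ (W p < W q' ∨ W p' < W q ∨ (W q < W q' ∧ W p' < W p)))

theorem Cfg.symm {W : ℤ → ℤ} {p q p' q' : ℤ} (h : Cfg W p q p' q') : Cfg W p' q' p q := by
  unfold Cfg at *; omega

/-- The local description of the atoms `W` of the involution `y`. -/
structure Atomic (W y : ℤ → ℤ) : Prop where
  invol : ∀ x, y (y x) = x
  desc : ∀ p, p ≤ y p → W (y p) ≤ W p
  pair : ∀ p p', p ≤ y p → p' ≤ y p' → p ≠ p' → Cfg W p (y p) p' (y p')

/-! ### Behaviour of the local conditions under simple transpositions -/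

theorem swap_succ_apply (k x : ℤ) :
    Equiv.swap k (k + 1) x = if x = k then k + 1 else if x = k + 1 then k else x :=
  Equiv.swap_apply_def k (k + 1) x

/-- No integer lies between `k` and `k + 1`, so whichever of them are minima or maxima of their
cycles, the allowed placements with `k + 1` first leave only this order of their partners. Hence a
last simple factor of the word can be removed together with a descent of the involution. -/
theorem Atomic.descent {W y : ℤ → ℤ} (h : Atomic W y) (k : ℤ) (hk : W (k + 1) < W k) :
    y (k + 1) < y k := by
  have i1 := h.invol k
  have i2 := h.invol (k + 1)
  by_contra hc
  rcases le_total k (y k) with h1 | h1 <;> rcases le_total (k + 1) (y (k + 1)) with h2 | h2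
  · have d1 := h.desc _ h1
    have d2 := h.desc _ h2
    have := h.pair _ _ h1 h2 (by omega)
    unfold Cfg at this; omega
  · have d1 := h.desc _ h1
    have d2 := h.desc (y (k + 1)) (by rwa [i2])
    have : k ≠ y (k + 1) := by
      rintro e; rw [← e] at i2; omega
    have := h.pair _ (y (k + 1)) h1 (by rwa [i2]) this
    rw [i2] at this d2
    unfold Cfg at this; omega
  · have d1 := h.desc (y k) (by rwa [i1])
    have d2 := h.desc _ h2
    have := h.pair (y k) _ (by rwa [i1]) h2 (by omega)
    rw [i1] at this d1
    unfold Cfg at this; omega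
  · have d1 := h.desc (y k) (by rwa [i1])
    have d2 := h.desc (y (k + 1)) (by rwa [i2])
    have : y k ≠ y (k + 1) := by
      rintro e; rw [← e] at i2; omega
    have := h.pair (y k) (y (k + 1)) (by rwa [i1]) (by rwa [i2]) this
    rw [i1, i2] at this
    rw [i1] at d1
    rw [i2] at d2
    unfold Cfg at this; omega

/-- Exchanging the names `k` and `k + 1` changes no comparison of letters except the one between
these two, so only the pair formed by their cycles needs checking. The equivalence `hk` lets the
lemma serve both for lengthening and for shortening a word. -/
theorem Atomic.relabel {W y : ℤ → ℤ} (h : Atomic W y) (k : ℤ) (h1 : y k ≠ k + 1)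
    (h2 : ¬ (y k = k ∧ y (k + 1) = k + 1)) (hk : W k < W (k + 1) ↔ y k < y (k + 1))
    (hW : W k ≠ W (k + 1)) :
    Atomic (fun x => W (Equiv.swap k (k + 1) x))
      (fun x => Equiv.swap k (k + 1) (y (Equiv.swap k (k + 1) x))) := by
  have h1' : y (k + 1) ≠ k := fun e => h1 (by
    have := h.invol (k + 1)
    rwa [e] at this)
  have hy : y k ≠ y (k + 1) := fun e => by
    have := h.invol k
    rw [e, h.invol] at this; omega
  -- As `k` and `k + 1` do not form a cycle, relabelling sends the smaller letter of a cycle to the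
  -- smaller letter of its image.
  have key : ∀ x, x ≤ Equiv.swap k (k + 1) (y (Equiv.swap k (k + 1) x)) →
      ∃ a, a ≤ y a ∧ x = Equiv.swap k (k + 1) a := by
    intro x hx
    refine ⟨Equiv.swap k (k + 1) x, ?_, by simp⟩
    generalize ha : Equiv.swap k (k + 1) x = a at *
    have hx' : x = Equiv.swap k (k + 1) a := by rw [← ha]; simp
    rw [hx'] at hx
    rw [swap_succ_apply, swap_succ_apply] at hx
    by_cases e1 : a = k
    · subst e1; split_ifs at hx <;> omega
    · by_cases e2 : a = k + 1
      · subst e2; split_ifs at hx <;> omega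
      · split_ifs at hx <;> omega
  constructor
  · intro x; simp [h.invol]
  · intro x hx
    obtain ⟨a, ha, rfl⟩ := key x hx
    simpa using h.desc a ha
  · intro x x' hx hx' hne
    obtain ⟨a, ha, rfl⟩ := key x hx
    obtain ⟨b, hb, rfl⟩ := key x' hx'
    have hab : a ≠ b := fun e => hne (by rw [e])
    have hc := h.pair a b ha hb hab
    have da := h.desc a ha
    have db := h.desc b hb
    have ia := h.invol a
    have ib := h.invol b
    clear key hx hx' hne
    have core : ∀ a b, a ≤ y a → b ≤ y b → a ≠ b → (a = k ∨ y a = k) →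
        (b = k + 1 ∨ y b = k + 1) → Cfg (fun x => W (Equiv.swap k (k + 1) x))
          (Equiv.swap k (k + 1) a) (Equiv.swap k (k + 1) (y a))
          (Equiv.swap k (k + 1) b) (Equiv.swap k (k + 1) (y b)) := by
      clear * - h h1 h2 hk hW hy h1'
      intro a b ha hb hab ca cb
      have hc := h.pair a b ha hb hab
      have da := h.desc a ha
      have db := h.desc b hb
      have ia := h.invol a
      have ib := h.invol b
      have fk : y k = k → W (y k) = W k := fun e => by rw [e]
      have fk1 : y (k + 1) = k + 1 → W (y (k + 1)) = W (k + 1) := fun e => by rw [e]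
      have ca' : (a = k ∧ y a = y k) ∨ (a = y k ∧ y a = k) := by
        rcases ca with e | e
        · exact Or.inl ⟨e, by rw [e]⟩
        · exact Or.inr ⟨by rw [← e, ia], e⟩
      have cb' : (b = k + 1 ∧ y b = y (k + 1)) ∨ (b = y (k + 1) ∧ y b = k + 1) := by
        rcases cb with e | e
        · exact Or.inl ⟨e, by rw [e]⟩
        · exact Or.inr ⟨by rw [← e, ib], e⟩
      unfold Cfg at hc ⊢
      simp only [Equiv.swap_apply_self]
      have s1 : Equiv.swap k (k + 1) k = k + 1 := by simp
      have s2 : Equiv.swap k (k + 1) (k + 1) = k := by simp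
      have s3 : Equiv.swap k (k + 1) (y k) = if y k = k then k + 1 else y k := by
        rw [swap_succ_apply]; split_ifs <;> omega
      have s4 : Equiv.swap k (k + 1) (y (k + 1)) =
          if y (k + 1) = k + 1 then k else y (k + 1) := by
        rw [swap_succ_apply]; split_ifs <;> omega
      clear ca cb ia ib
      obtain ⟨e1, e2⟩ | ⟨e1, e2⟩ := ca' <;> obtain ⟨e3, e4⟩ | ⟨e3, e4⟩ := cb'
      all_goals
        rw [e2, e4] at hc ⊢
        rw [e2] at ha da
        rw [e4] at hb db
        rw [e1] at ha da hab
        rw [e3] at hb db hab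
        rw [e1, e3] at hc ⊢
        rw [s1, s2, s3, s4]
        clear e1 e2 e3 e4 s1 s2 s3 s4
        generalize y k = m at *
        generalize y (k + 1) = n at *
        split_ifs <;> omega
    simp only [Equiv.swap_apply_self]
    by_cases c1 : (a = k ∨ y a = k) ∧ (b = k + 1 ∨ y b = k + 1)
    · exact core a b ha hb hab c1.1 c1.2
    by_cases c2 : (a = k + 1 ∨ y a = k + 1) ∧ (b = k ∨ y b = k)
    · exact (core b a hb ha hab.symm c2.2 c2.1).symm
    -- For all remaining pairs of cycles the relabelling preserves the comparisons between minima
    -- and between maxima, and no position moves.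
    have mono : ∀ u v, ¬ (u = k ∧ v = k + 1) → ¬ (u = k + 1 ∧ v = k) →
        (Equiv.swap k (k + 1) u < Equiv.swap k (k + 1) v ↔ u < v) := by
      intro u v _ _
      rw [swap_succ_apply, swap_succ_apply]; split_ifs <;> omega
    unfold Cfg at hc ⊢
    simp only [Equiv.swap_apply_self]
    rwa [mono a b (fun e => c1 ⟨.inl e.1, .inl e.2⟩) (fun e => c2 ⟨.inl e.1, .inl e.2⟩),
      mono b a (fun e => c2 ⟨.inl e.2, .inl e.1⟩) (fun e => c1 ⟨.inl e.2, .inl e.1⟩),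
      mono (y a) (y b) (fun e => c1 ⟨.inr e.1, .inr e.2⟩) (fun e => c2 ⟨.inr e.1, .inr e.2⟩),
      mono (y b) (y a) (fun e => c2 ⟨.inr e.2, .inr e.1⟩) (fun e => c1 ⟨.inr e.2, .inr e.1⟩)]

/-- The fixed points `k` and `k + 1` stand in increasing order; exchanging them yields the order
required of a cycle. Its placement against a third cycle follows from the placements of the two
fixed points, since no letter lies between them in value. -/
theorem Atomic.add {W y : ℤ → ℤ} (h : Atomic W y) (k : ℤ) (h1 : y k = k)
    (h2 : y (k + 1) = k + 1) :
    Atomic (fun x => W (Equiv.swap k (k + 1) x)) (fun x => y (Equiv.swap k (k + 1) x)) := by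
  have hk : W k < W (k + 1) := by
    have := h.pair k (k + 1) h1.ge h2.ge (by omega)
    rw [h1, h2] at this
    unfold Cfg at this; omega
  have ne : ∀ x, x ≠ k → x ≠ k + 1 → y x ≠ k ∧ y x ≠ k + 1 := by
    intro x a b
    refine ⟨fun e => a ?_, fun e => b ?_⟩
    · rw [← h.invol x, e, h1]
    · rw [← h.invol x, e, h2]
  have s1 : Equiv.swap k (k + 1) k = k + 1 := by simp
  have s2 : Equiv.swap k (k + 1) (k + 1) = k := by simp
  have s3 : ∀ x, x ≠ k → x ≠ k + 1 → Equiv.swap k (k + 1) x = x := fun x a b =>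
    Equiv.swap_apply_of_ne_of_ne a b
  have new : ∀ x, x ≤ y x → x ≠ k → x ≠ k + 1 →
      Cfg (fun x => W (Equiv.swap k (k + 1) x)) k (k + 1) x (y x) := by
    intro x hx a b
    have c1 := h.pair k x h1.ge hx (Ne.symm a)
    have c2 := h.pair (k + 1) x h2.ge hx (Ne.symm b)
    have c3 := h.desc x hx
    obtain ⟨n1, n2⟩ := ne x a b
    unfold Cfg at *
    simp only [s1, s2, s3 x a b, s3 _ n1 n2]
    rw [h1] at c1
    rw [h2] at c2
    omega
  have cyc : ∀ x, x ≤ y (Equiv.swap k (k + 1) x) →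
      (x = k ∧ y (Equiv.swap k (k + 1) x) = k + 1) ∨
      (x ≠ k ∧ x ≠ k + 1 ∧ x ≤ y x ∧ y (Equiv.swap k (k + 1) x) = y x) := by
    intro x hx
    by_cases a : x = k
    · left; rw [a, s1, h2]; simp
    by_cases b : x = k + 1
    · rw [b, s2, h1] at hx; omega
    · rw [s3 x a b] at hx ⊢; simp [a, b, hx]
  constructor
  · intro x
    by_cases a : x = k
    · rw [a, s1, h2, s2, h1]
    by_cases b : x = k + 1
    · rw [b, s2, h1, s1, h2]
    · rw [s3 x a b, s3 _ (ne x a b).1 (ne x a b).2, h.invol]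
  · intro x hx
    obtain ⟨rfl, e⟩ | ⟨a, b, c, e⟩ := cyc x hx
    · rw [e, s1, s2]; exact hk.le
    · rw [e, s3 x a b, s3 _ (ne x a b).1 (ne x a b).2]; exact h.desc x c
  · intro x x' hx hx' hne
    obtain ⟨ex, e⟩ | ⟨a, b, c, e⟩ := cyc x hx <;>
      obtain ⟨ex', e'⟩ | ⟨a', b', c', e'⟩ := cyc x' hx'
    · omega
    · rw [e, e', ex]; exact new x' c' a' b'
    · rw [e, e', ex']; exact (new x c a b).symm
    · rw [e, e']
      have := h.pair x x' c c' hne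
      unfold Cfg at this ⊢
      simpa only [s3 x a b, s3 x' a' b', s3 _ (ne x a b).1 (ne x a b).2,
        s3 _ (ne x' a' b').1 (ne x' a' b').2] using this

theorem Atomic.remove {W y : ℤ → ℤ} (h : Atomic W y) (k : ℤ) (h1 : y k = k + 1)
    (hk : W (k + 1) < W k) :
    Atomic (fun x => W (Equiv.swap k (k + 1) x)) (fun x => y (Equiv.swap k (k + 1) x)) := by
  have h2 : y (k + 1) = k := by rw [← h1, h.invol]
  have ne : ∀ x, x ≠ k → x ≠ k + 1 → y x ≠ k ∧ y x ≠ k + 1 := by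
    intro x a b
    refine ⟨fun e => b ?_, fun e => a ?_⟩
    · rw [← h.invol x, e, h1]
    · rw [← h.invol x, e, h2]
  have s1 : Equiv.swap k (k + 1) k = k + 1 := by simp
  have s2 : Equiv.swap k (k + 1) (k + 1) = k := by simp
  have s3 : ∀ x, x ≠ k → x ≠ k + 1 → Equiv.swap k (k + 1) x = x := fun x a b =>
    Equiv.swap_apply_of_ne_of_ne a b
  have new : ∀ x, x ≤ y x → x ≠ k → x ≠ k + 1 →
      Cfg (fun x => W (Equiv.swap k (k + 1) x)) k k x (y x) ∧
      Cfg (fun x => W (Equiv.swap k (k + 1) x)) (k + 1) (k + 1) x (y x) := by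
    intro x hx a b
    have c1 := h.pair k x (by omega) hx (Ne.symm a)
    have c3 := h.desc x hx
    obtain ⟨n1, n2⟩ := ne x a b
    unfold Cfg at *
    simp only [s1, s2, s3 x a b, s3 _ n1 n2]
    rw [h1] at c1
    constructor <;> omega
  have cyc : ∀ x, y (Equiv.swap k (k + 1) x) = x ∧ (x = k ∨ x = k + 1) ∨
      (x ≠ k ∧ x ≠ k + 1 ∧ y (Equiv.swap k (k + 1) x) = y x) := by
    intro x
    by_cases a : x = k
    · left; rw [a, s1, h2]; simp
    by_cases b : x = k + 1
    · left; rw [b, s2, h1]; simp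
    · rw [s3 x a b]; simp [a, b]
  constructor
  · intro x
    obtain ⟨e, -⟩ | ⟨a, b, e⟩ := cyc x
    · rw [e, e]
    · rw [e, s3 _ (ne x a b).1 (ne x a b).2, h.invol]
  · intro x hx
    obtain ⟨e, -⟩ | ⟨a, b, e⟩ := cyc x
    · rw [e]
    · rw [e] at hx ⊢
      rw [s3 x a b, s3 _ (ne x a b).1 (ne x a b).2]; exact h.desc x hx
  · intro x x' hx hx' hne
    obtain ⟨e, ex⟩ | ⟨a, b, e⟩ := cyc x <;> obtain ⟨e', ex'⟩ | ⟨a', b', e'⟩ := cyc x'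
    · rw [e, e']
      unfold Cfg
      obtain rfl | rfl := ex <;> obtain rfl | rfl := ex'
      · omega
      · simp only [s1, s2]; omega
      · simp only [s1, s2]; omega
      · omega
    · rw [e'] at hx'
      rw [e, e']
      obtain rfl | rfl := ex
      exacts [(new x' hx' a' b').1, (new x' hx' a' b').2]
    · rw [e] at hx
      rw [e, e']
      obtain rfl | rfl := ex'
      exacts [(new x hx a b).1.symm, (new x hx a b).2.symm]
    · rw [e] at hx ⊢
      rw [e'] at hx' ⊢
      have := h.pair x x' hx hx' hne
      unfold Cfg at this ⊢
      simpa only [s3 x a b, s3 x' a' b', s3 _ (ne x a b).1 (ne x a b).2,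
        s3 _ (ne x' a' b').1 (ne x' a' b').2] using this

/-! ### Demazure conjugation of involutions and its effect on length -/

theorem len_inv (w : SZ) : len w⁻¹ = len w := by
  have h : Inv w = (fun p : ℤ × ℤ => ((w⁻¹).1 p.2, (w⁻¹).1 p.1)) '' Inv w⁻¹ := by
    have e1 : ∀ a, w.1 ((w⁻¹).1 a) = a := fun a => by
      rw [← mul_apply, mul_inv_cancel]; rfl
    have e2 : ∀ a, (w⁻¹).1 (w.1 a) = a := fun a => by
      rw [← mul_apply, inv_mul_cancel]; rfl
    ext ⟨a, b⟩
    simp only [Inv, Set.mem_ofPred_eq, Set.mem_image, Prod.mk.injEq, Prod.exists]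
    constructor
    · rintro ⟨h1, h2⟩
      exact ⟨w.1 b, w.1 a, ⟨h2, by rwa [e2, e2]⟩, e2 a, e2 b⟩
    · rintro ⟨c, d, ⟨h1, h2⟩, rfl, rfl⟩
      exact ⟨h2, by rwa [e1, e1]⟩
  rw [len, len, h, Set.ncard_image_of_injective]
  rintro ⟨a, b⟩ ⟨c, d⟩ hp
  simp only [Prod.mk.injEq, EmbeddingLike.apply_eq_iff_eq] at hp
  rw [hp.1, hp.2]

theorem demazure_simple (u : SZ) (i : ℤ) : demazure u (simple i) = rop i u :=
  isDemazureProduct_demazure.apply_simple u i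

theorem len_simple (i : ℤ) : len (simple i) = 1 := by
  have := len_mul_simple 1 i (by change i < i + 1; omega)
  rwa [one_mul, len_one] at this

theorem simple_demazure (i : ℤ) (u : SZ) : demazure (simple i) u = lop i u := by
  have D := isDemazureProduct_demazure
  have up : ∀ v : SZ, (v⁻¹).1 i < (v⁻¹).1 (i + 1) → demazure (simple i) v = simple i * v := by
    intro v h
    apply D.mul
    rw [← len_inv, mul_inv_rev, simple_inv, len_mul_simple _ _ h, len_inv, len_simple, add_comm]
  rw [lop_eq]
  rcases lt_or_gt u⁻¹ i with h | h
  · exact (up u h).trans (if_pos h).symm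
  · refine Eq.trans ?_ (if_neg (not_lt.mpr h.le)).symm
    have h1 := up (simple i * u) (by
      rw [mul_inv_rev, simple_inv]; exact (mul_simple_lt_iff _ _).2 h)
    rw [← mul_assoc, simple_mul_self, one_mul] at h1
    calc demazure (simple i) u = demazure (simple i) (demazure (simple i) (simple i * u)) := by
          rw [h1]
      _ = u := by rw [← D.assoc, D.idem, h1]

/-- The Demazure conjugation `v ↦ s ∘ v ∘ s`. -/
theorem demazure_inv_mul_simple (v : SZ) (k : ℤ) (h : v.1 k < v.1 (k + 1)) :
    demazure (v * simple k)⁻¹ (v * simple k) = lop k (rop k (demazure v⁻¹ v)) := by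
  have D := isDemazureProduct_demazure
  have e1 : v * simple k = demazure v (simple k) := by rw [demazure_simple, rop, if_pos h]
  have e2 : (v * simple k)⁻¹ = demazure (simple k) v⁻¹ := by
    rw [simple_demazure, lop, inv_inv, rop, if_pos h]
  rw [e2, e1, D.assoc, ← D.assoc v⁻¹, demazure_simple, simple_demazure]

theorem IZ_apply {y : SZ} (hy : y ∈ IZ) (x : ℤ) : y.1 (y.1 x) = x := by
  have h : y * y = 1 := mul_eq_one_iff_eq_inv.2 (Eq.symm hy)
  rw [← mul_apply, h]; rfl

theorem mem_IZ {y : SZ} (hy : ∀ x, y.1 (y.1 x) = x) : y ∈ IZ := by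
  have h : y * y = 1 := Subtype.ext (Equiv.ext hy)
  exact (mul_eq_one_iff_eq_inv.1 h).symm

theorem lop_rop_of_gt {y : SZ} (hy : y ∈ IZ) (k : ℤ) (h : y.1 (k + 1) < y.1 k) :
    lop k (rop k y) = y := by
  have hy' : y⁻¹ = y := hy
  rw [rop, if_neg h.not_gt, lop, hy', rop, if_neg h.not_gt, hy']

theorem simple_apply_self (k : ℤ) : (simple k).1 k = k + 1 := by simp [simple_apply]

theorem simple_apply_succ (k : ℤ) : (simple k).1 (k + 1) = k := by simp [simple_apply]

theorem simple_simple_apply (k x : ℤ) : (simple k).1 ((simple k).1 x) = x := by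
  rw [← mul_apply, simple_mul_self]; rfl

theorem lop_rop_of_fixed {y : SZ} (hy : y ∈ IZ) (k : ℤ) (h1 : y.1 k = k)
    (h2 : y.1 (k + 1) = k + 1) : lop k (rop k y) = y * simple k := by
  have hy' : y⁻¹ = y := hy
  rw [rop, if_pos (by omega), lop, mul_inv_rev, hy', simple_inv, rop, if_neg, mul_inv_rev, hy',
    simple_inv]
  rw [mul_apply, mul_apply, h1, h2, simple_apply_self, simple_apply_succ]
  omega

theorem lop_rop_of_lt {y : SZ} (hy : y ∈ IZ) (k : ℤ) (h : y.1 k < y.1 (k + 1))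
    (h2 : ¬ (y.1 k = k ∧ y.1 (k + 1) = k + 1)) :
    lop k (rop k y) = simple k * y * simple k := by
  have hy' : y⁻¹ = y := hy
  rw [rop, if_pos h, lop, mul_inv_rev, hy', simple_inv, rop, if_pos]
  · rw [mul_inv_rev, mul_inv_rev, hy', simple_inv, mul_assoc]
  · rw [mul_apply, mul_apply, simple_apply, simple_apply]
    split_ifs <;> omega

theorem conj_mem_IZ {y : SZ} (hy : y ∈ IZ) (k : ℤ) : simple k * y * simple k ∈ IZ := by
  have hy' : y⁻¹ = y := hy
  change (simple k * y * simple k)⁻¹ = _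
  rw [mul_inv_rev, mul_inv_rev, hy', simple_inv, mul_assoc]

theorem mul_simple_mem_IZ {y : SZ} (hy : y ∈ IZ) (k : ℤ) (h1 : y.1 k = k ∨ y.1 k = k + 1)
    (h2 : y.1 (k + 1) = k + 1 ∨ y.1 (k + 1) = k) : y * simple k ∈ IZ := by
  have hy' : y⁻¹ = y := hy
  change (y * simple k)⁻¹ = _
  rw [mul_inv_rev, hy', simple_inv]
  apply Subtype.ext
  have := Equiv.mul_swap_eq_swap_mul y.1 k (k + 1)
  have h3 : Equiv.swap (y.1 k) (y.1 (k + 1)) = Equiv.swap k (k + 1) := by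
    have hne : y.1 k ≠ y.1 (k + 1) := fun e => by have := y.1.injective e; omega
    rcases h1 with h1 | h1 <;> rcases h2 with h2 | h2
    · rw [h1, h2]
    · omega
    · omega
    · rw [h1, h2, Equiv.swap_comm]
  rw [h3] at this
  exact this.symm

theorem lop_rop_mem_IZ {y : SZ} (hy : y ∈ IZ) (k : ℤ) : lop k (rop k y) ∈ IZ := by
  rcases lt_or_gt y k with h | h
  · by_cases h2 : y.1 k = k ∧ y.1 (k + 1) = k + 1
    · rw [lop_rop_of_fixed hy k h2.1 h2.2]
      exact mul_simple_mem_IZ hy k (.inl h2.1) (.inl h2.2)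
    · rw [lop_rop_of_lt hy k h h2]
      exact conj_mem_IZ hy k
  · rwa [lop_rop_of_gt hy k h]

theorem demazure_inv_self_mem_IZ (w : SZ) : demazure w⁻¹ w ∈ IZ := by
  induction w using right_induction with
  | one =>
    rw [isDemazureProduct_demazure.mul _ _ (by simp [len_one])]
    simp [IZ]
  | step v k h ih =>
    rw [demazure_inv_mul_simple v k h]
    exact lop_rop_mem_IZ ih k

theorem demazure_one_one : demazure (1 : SZ)⁻¹ 1 = 1 := by
  rw [isDemazureProduct_demazure.mul _ _ (by simp [len_one])]; simp

/-- The points that `y` moves. -/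
def supp (y : SZ) : Set ℤ := {x | y.1 x ≠ x}

theorem supp_conj (y : SZ) (k : ℤ) :
    (supp (simple k * y * simple k)).ncard = (supp y).ncard := by
  have : supp (simple k * y * simple k) = (simple k).1 '' supp y := by
    ext x
    simp only [supp, Set.mem_ofPred_eq, Set.mem_image, mul_apply]
    constructor
    · intro h
      refine ⟨(simple k).1 x, fun e => h ?_, simple_simple_apply k x⟩
      rw [e, simple_simple_apply]
    · rintro ⟨a, h, rfl⟩ e
      rw [simple_simple_apply] at e
      exact h ((simple k).1.injective e)
  rw [this, Set.ncard_image_of_injective _ (simple k).1.injective]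

theorem supp_mul_simple (y : SZ) (k : ℤ) (h1 : y.1 k = k + 1) (h2 : y.1 (k + 1) = k) :
    (supp y).ncard = (supp (y * simple k)).ncard + 2 := by
  have : supp y = insert k (insert (k + 1) (supp (y * simple k))) := by
    ext x
    simp only [supp, Set.mem_ofPred_eq, Set.mem_insert_iff, mul_apply]
    by_cases a : x = k
    · subst a; simp [h1]
    by_cases b : x = k + 1
    · subst b; simp [h2]
    · rw [simple_apply, if_neg a, if_neg b]; simp [a, b]
  have fin : (supp (y * simple k)).Finite := (y * simple k).2
  rw [this, Set.ncard_insert_of_notMem _ (fin.insert _), Set.ncard_insert_of_notMem _ fin]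
  · simp [supp, simple_apply_succ, h1]
  · simp [supp, simple_apply_self, h2]

/-- The descent at `k` removes one inversion on the right. As `(k,k+1)` is not a cycle, the left
factor then removes a second one. -/
theorem len_conj {y : SZ} (hy : y ∈ IZ) (k : ℤ) (h : y.1 (k + 1) < y.1 k) (h1 : y.1 k ≠ k + 1) :
    len y = len (simple k * y * simple k) + 2 := by
  have hy' : y⁻¹ = y := hy
  have e1 := len_mul_simple_of_gt y k h
  have e2 : len (y * simple k) = len (simple k * y) := by
    rw [← len_inv, mul_inv_rev, hy', simple_inv]
  have e3 := len_mul_simple_of_gt (simple k * y) k (by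
    have := IZ_apply hy k
    have h1' : y.1 (k + 1) ≠ k := fun e => h1 (by
      have := IZ_apply hy (k + 1)
      rwa [e] at this)
    rw [mul_apply, mul_apply, simple_apply, simple_apply]
    split_ifs <;> omega)
  omega

/-! ### The local conditions characterize atoms -/

/-- Removing a descent of `w` either deletes the cycle `(k,k+1)`, so that `ℓ(y)` drops by 1 and the
support by 2, or conjugates `y`, so that `ℓ(y)` drops by 2 and the support keeps its size. The
formula says that `ℓ(w)` is half the sum of `ℓ(y)` and the number of 2-cycles; the factor 4 avoids
division. -/
theorem Atomic.demazure_and_len {w y : SZ} (hA : Atomic w.1 y.1) :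
    demazure w⁻¹ w = y ∧ 4 * len w = 2 * len y + (supp y).ncard := by
  induction w using right_induction generalizing y with
  | one =>
    have : y = 1 := by
      apply Subtype.ext
      ext x
      have i := hA.invol x
      rcases le_total x (y.1 x) with h | h
      · exact le_antisymm (hA.desc x h) h
      · have := hA.desc (y.1 x) (by rwa [i])
        rw [i] at this
        exact le_antisymm h this
    subst this
    refine ⟨demazure_one_one, ?_⟩
    have : supp 1 = ∅ := by ext; simp [supp]
    simp [len_one, this]
  | step v k h ih =>
    have hy := mem_IZ hA.invol
    have hw : (v * simple k).1 (k + 1) < (v * simple k).1 k := by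
      rwa [mul_apply, mul_apply, simple_apply_self, simple_apply_succ]
    have hd := hA.descent k hw
    have hl := len_mul_simple v k h
    have ev : ∀ x, (v * simple k).1 ((simple k).1 x) = v.1 x := fun x => by
      rw [mul_apply, simple_simple_apply]
    by_cases h1 : y.1 k = k + 1
    · have h2 : y.1 (k + 1) = k := by rw [← h1, IZ_apply hy]
      have hA' : Atomic v.1 (y * simple k).1 := by
        have := hA.remove k h1 hw
        have e : (fun x => (v * simple k).1 (Equiv.swap k (k + 1) x)) = v.1 := funext ev
        rw [e] at this
        exact this
      obtain ⟨g1, g2⟩ := ih hA'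
      have g3 := supp_mul_simple y k h1 h2
      have g4 := len_mul_simple_of_gt y k hd
      refine ⟨?_, by omega⟩
      rw [demazure_inv_mul_simple v k h, g1, lop_rop_of_fixed (mem_IZ hA'.invol), mul_assoc,
        simple_mul_self, mul_one]
      · rw [mul_apply, simple_apply_self, h2]
      · rw [mul_apply, simple_apply_succ, h1]
    · have h1' : y.1 (k + 1) ≠ k := fun e => h1 (by
        have := IZ_apply hy (k + 1)
        rwa [e] at this)
      have hA' : Atomic v.1 (simple k * y * simple k).1 := by
        have := hA.relabel k h1 (by omega) (by omega) hw.ne'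
        have e : (fun x => (v * simple k).1 (Equiv.swap k (k + 1) x)) = v.1 := funext ev
        rw [e] at this
        exact this
      obtain ⟨g1, g2⟩ := ih hA'
      have g3 := supp_conj y k
      have g4 := len_conj hy k hd h1
      refine ⟨?_, by omega⟩
      have k1 : (simple k * y * simple k).1 k = (simple k).1 (y.1 (k + 1)) := by
        rw [mul_apply, mul_apply, simple_apply_self]
      have k2 : (simple k * y * simple k).1 (k + 1) = (simple k).1 (y.1 k) := by
        rw [mul_apply, mul_apply, simple_apply_succ]
      rw [demazure_inv_mul_simple v k h, g1, lop_rop_of_lt (mem_IZ hA'.invol)]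
      · rw [mul_assoc, mul_assoc, mul_assoc, simple_mul_self, mul_one, ← mul_assoc,
          simple_mul_self, one_mul]
      · rw [k1, k2, simple_apply, simple_apply]
        split_ifs <;> omega
      · rw [k1, k2, simple_apply, simple_apply]
        split_ifs <;> omega

theorem atomic_one : Atomic (1 : SZ).1 (1 : SZ).1 where
  invol x := rfl
  desc p _ := le_rfl
  pair p p' _ _ h := by
    change Cfg id p p p' p'
    unfold Cfg
    simp only [id]; omega

/-- Minimality passes to the shorter word `v`, and it forces the last Demazure conjugation to change
the involution; it is then one of the two moves that preserve the local conditions. -/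
theorem atomic_of_mem_atoms {w y : SZ} (h : w ∈ atoms y) : Atomic w.1 y.1 := by
  induction w using right_induction generalizing y with
  | one =>
    have : y = 1 := h.1.trans demazure_one_one
    rw [this]; exact atomic_one
  | step v k hv ih =>
    obtain ⟨h1, h2⟩ := h
    rw [demazure_inv_mul_simple v k hv] at h1
    have hl := len_mul_simple v k hv
    have hm : v ∈ atoms (demazure v⁻¹ v) := by
      refine ⟨rfl, fun u hu => ?_⟩
      -- Let `u` be shorter than `v` with the same involution. If `k` is an ascent of `u`, then `u *
      -- simple k` is shorter than `v * simple k`. If it is a descent, the common involution already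
      -- descends at `k`, so conjugation fixes it and `v` itself is shorter than `v * simple k`.
      by_contra hc
      rcases lt_or_gt u k with h | h
      · have := h2 (u * simple k) (by rw [demazure_inv_mul_simple u k h, ← hu, h1])
        have := len_mul_simple u k h
        omega
      · have e := demazure_inv_mul_simple (u * simple k) k ((mul_simple_lt_iff u k).2 h)
        rw [mul_assoc, simple_mul_self, mul_one, ← hu] at e
        have hy0 := demazure_inv_self_mem_IZ (u * simple k)
        have hd : (demazure v⁻¹ v).1 (k + 1) < (demazure v⁻¹ v).1 k := by
          rw [e]
          set y0 := demazure (u * simple k)⁻¹ (u * simple k)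
          rcases lt_or_gt y0 k with h | h
          · by_cases h3 : y0.1 k = k ∧ y0.1 (k + 1) = k + 1
            · rw [lop_rop_of_fixed hy0 k h3.1 h3.2, mul_apply, mul_apply, simple_apply_self,
                simple_apply_succ]
              exact h
            · rw [lop_rop_of_lt hy0 k h h3, mul_apply, mul_apply, mul_apply, mul_apply,
                simple_apply_self, simple_apply_succ, simple_apply, simple_apply]
              split_ifs <;> omega
          · rwa [lop_rop_of_gt hy0 k h]
        rw [lop_rop_of_gt (demazure_inv_self_mem_IZ v) k hd] at h1
        have := h2 v h1
        omega
    have hA := ih hm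
    have hy0 := demazure_inv_self_mem_IZ v
    set y0 := demazure v⁻¹ v with hy0_def
    rcases lt_or_gt y0 k with h | h
    · by_cases h3 : y0.1 k = k ∧ y0.1 (k + 1) = k + 1
      · rw [h1, lop_rop_of_fixed hy0 k h3.1 h3.2]
        exact hA.add k h3.1 h3.2
      · rw [h1, lop_rop_of_lt hy0 k h h3]
        refine hA.relabel k (fun e => ?_) h3 (iff_of_true hv h) hv.ne
        have := IZ_apply hy0 k
        rw [e] at this
        omega
    · rw [lop_rop_of_gt hy0 k h] at h1
      have := h2 v h1
      omega

/-- For the converse, a shortest solution exists and satisfies the local conditions, so by the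
length formula it has the length of `w`. -/
theorem mem_atoms_iff {w y : SZ} : w ∈ atoms y ↔ Atomic w.1 y.1 := by
  refine ⟨atomic_of_mem_atoms, fun h => ?_⟩
  obtain ⟨h1, h2⟩ := h.demazure_and_len
  refine ⟨h1.symm, fun v hv => ?_⟩
  let S : Set SZ := {u | y = demazure u⁻¹ u}
  have hS : S.Nonempty := ⟨w, h1.symm⟩
  have hm : Function.argminOn len S hS ∈ atoms y :=
    ⟨Function.argminOn_mem len S hS, fun u hu => Function.argminOn_le len S hu⟩
  have h3 := (atomic_of_mem_atoms hm).demazure_and_len.2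
  have h4 := hm.2 v hv
  omega

/-! ### Bruhat covers as exchanges of letters -/

theorem tr_apply (i j x : ℤ) : (tr i j).1 x = if x = i then j else if x = j then i else x :=
  Equiv.swap_apply_def i j x

theorem tr_mul_self (i j : ℤ) : tr i j * tr i j = 1 := Subtype.ext (Equiv.swap_mul_self i j)

/-- Apply `t` to both entries of an inversion when this keeps them increasing, and leave the
inversion alone otherwise. This injects the inversions of `w` into those of `w * t` and misses
`(i,j)`. -/
theorem len_lt_len_mul_tr (w : SZ) (i j : ℤ) (hij : i < j) (h : w.1 i < w.1 j) :
    len w < len (w * tr i j) := by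
  classical
  set t := tr i j with ht
  have tt : ∀ x, t.1 (t.1 x) = x := fun x => by rw [← mul_apply, tr_mul_self]; rfl
  let f : ℤ × ℤ → ℤ × ℤ := fun p => if t.1 p.1 < t.1 p.2 then (t.1 p.1, t.1 p.2) else p
  have hf : ∀ a b, (t.1 a < t.1 b ∧ f (a, b) = (t.1 a, t.1 b)) ∨
      (¬ t.1 a < t.1 b ∧ f (a, b) = (a, b)) := by
    intro a b
    by_cases hc : t.1 a < t.1 b
    · exact Or.inl ⟨hc, if_pos hc⟩
    · exact Or.inr ⟨hc, if_neg hc⟩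
  have hmem : (i, j) ∈ Inv (w * t) := by
    refine ⟨hij, ?_⟩
    change w.1 (t.1 j) < w.1 (t.1 i)
    simp only [ht, tr_apply]
    split_ifs <;> omega
  have hsub : f '' Inv w ⊆ Inv (w * t) \ {(i, j)} := by
    rintro _ ⟨⟨a, b⟩, ⟨h1, h2⟩, rfl⟩
    simp only at h1 h2
    obtain ⟨hc, e⟩ | ⟨hc, e⟩ := hf a b
    · rw [e]
      refine ⟨⟨hc, ?_⟩, ?_⟩
      · change w.1 (t.1 (t.1 b)) < w.1 (t.1 (t.1 a))
        rwa [tt, tt]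
      · simp only [Set.mem_singleton_iff, Prod.mk.injEq, ht, tr_apply]
        split_ifs <;> omega
    · rw [e]
      refine ⟨⟨h1, ?_⟩, ?_⟩
      · change w.1 (t.1 b) < w.1 (t.1 a)
        simp only [ht, tr_apply] at hc ⊢
        by_cases a1 : a = i
        · subst a1
          by_cases b1 : b = j
          · subst b1; omega
          · split_ifs at hc ⊢ <;> omega
        · by_cases b1 : b = j
          · subst b1
            split_ifs at hc ⊢ <;> omega
          · split_ifs at hc ⊢ <;> omega
      · simp only [Set.mem_singleton_iff, Prod.mk.injEq]
        rintro ⟨rfl, rfl⟩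
        omega
  have hinj : Set.InjOn f (Inv w) := by
    rintro ⟨a, b⟩ ⟨h1, -⟩ ⟨c, d⟩ ⟨h2, -⟩ hp
    simp only at h1 h2
    obtain ⟨hc, e⟩ | ⟨hc, e⟩ := hf a b <;> obtain ⟨hc', e'⟩ | ⟨hc', e'⟩ := hf c d <;>
      rw [e, e', Prod.mk.injEq] at hp <;> obtain ⟨p1, p2⟩ := hp
    · rw [t.1.injective p1, t.1.injective p2]
    · rw [← p1, ← p2, tt, tt] at hc'; omega
    · rw [p1, p2, tt, tt] at hc; omega
    · rw [p1, p2]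
  have c1 := Set.ncard_le_ncard hsub ((finite_Inv _).sdiff)
  rw [hinj.ncard_image] at c1
  have c2 := Set.ncard_sdiff_singleton_lt_of_mem hmem (finite_Inv _)
  exact c1.trans_lt c2

theorem BruhatLT.len_lt {u v : SZ} (h : BruhatLT u v) : len u < len v := by
  induction h with
  | single h => obtain ⟨i, j, -, -, h⟩ := h; exact h
  | tail _ h ih => obtain ⟨i, j, -, -, h⟩ := h; exact ih.trans h

theorem bruhatLT_mul_tr (w : SZ) (i j : ℤ) (hij : i < j) (h : w.1 i < w.1 j) :
    BruhatLT w (w * tr i j) :=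
  .single ⟨i, j, hij.ne, rfl, len_lt_len_mul_tr w i j hij h⟩

theorem Covers.bruhatLT {u v : SZ} (h : Covers u v) : BruhatLT u v :=
  (h.ge rfl : u ∈ {σ : SZ | BruhatLE u σ ∧ BruhatLT σ v}).2

theorem Covers.lt {w : SZ} {i j : ℤ} (hij : i < j) (h : Covers w (w * tr i j)) :
    w.1 i < w.1 j := by
  by_contra hc
  have hne : w.1 i ≠ w.1 j := fun e => hij.ne (w.1.injective e)
  have h1 := h.bruhatLT.len_lt
  have h2 := len_lt_len_mul_tr (w * tr i j) i j hij (by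
    rw [mul_apply, mul_apply, tr_apply, tr_apply]
    split_ifs <;> omega)
  rw [mul_assoc, tr_mul_self, mul_one] at h2
  omega

theorem Covers.not_between {w : SZ} {i j : ℤ} (h : Covers w (w * tr i j)) (e : ℤ)
    (h1 : i < e) (h2 : e < j) : ¬ (w.1 i < w.1 e ∧ w.1 e < w.1 j) := by
  rintro ⟨h3, h4⟩
  -- An intermediate `e` would give `w < w(i,e) < w(i,e)(e,j) < w(i,e)(e,j)(i,e)`, whose last term
  -- is `w(i,j)`.
  have b1 := bruhatLT_mul_tr w i e h1 h3
  have b2 := bruhatLT_mul_tr (w * tr i e) e j h2 (by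
    rw [mul_apply, mul_apply, tr_apply, tr_apply]
    split_ifs <;> omega)
  have b3 := bruhatLT_mul_tr (w * tr i e * tr e j) i e h1 (by
    simp only [mul_apply, tr_apply]
    split_ifs <;> omega)
  have e1 : w * tr i e * tr e j * tr i e = w * tr i j := by
    rw [mul_assoc, mul_assoc]
    congr 1
    apply Subtype.ext
    ext x
    change (tr i e).1 ((tr e j).1 ((tr i e).1 x)) = (tr i j).1 x
    simp only [tr_apply]
    split_ifs <;> omega
  rw [e1] at b3
  have hm : w * tr i e ∈ {σ : SZ | BruhatLE w σ ∧ BruhatLT σ (w * tr i j)} :=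
    ⟨Or.inr b1, b2.trans b3⟩
  rw [h] at hm
  have := b1.len_lt
  rw [Set.mem_singleton_iff.1 hm] at this
  omega

/-! ### Exchanges that never produce an atom -/

/-- In the word of an atom, a letter `b` standing before a smaller letter `a` either forms a cycle
with `a`, or one of their cycles encloses the other, or their cycles cross. -/
theorem Atomic.inversion {W y : ℤ → ℤ} (h : Atomic W y) (hW : W.Injective) {a b : ℤ}
    (hab : a < b) (hba : W b < W a) :
    y b = a ∨
    (y b < a ∧ y b < y a ∧ y a < b ∧ W b < W (y b) ∧ W (y b) < W a) ∨
    (b < y a ∧ y b < y a ∧ a < y b ∧ W b < W (y a) ∧ W (y a) < W a) ∨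
    (y b < a ∧ b < y a ∧ W b < W (y b) ∧ W (y b) < W (y a) ∧ W (y a) < W a) := by
  have i1 := h.invol a
  have i2 := h.invol b
  by_cases e : y b = a
  · exact Or.inl e
  right
  have e' : y a ≠ b := fun c => e (by rw [← c, i1])
  have e2 : y a ≠ y b := fun c => hab.ne (by rw [← i1, c, i2])
  have w1 : y b ≠ b → W (y b) ≠ W b := fun c d => c (hW d)
  have w2 : y a ≠ a → W (y a) ≠ W a := fun c d => c (hW d)
  have w3 : W (y b) ≠ W a := fun d => e (hW d)
  have w4 : W (y a) ≠ W b := fun d => e' (hW d)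
  rcases le_total a (y a) with h1 | h1 <;> rcases le_total b (y b) with h2 | h2
  · have d1 := h.desc _ h1
    have d2 := h.desc _ h2
    have := h.pair _ _ h1 h2 hab.ne
    unfold Cfg at this; omega
  · have d1 := h.desc _ h1
    have d2 := h.desc (y b) (by rwa [i2])
    have := h.pair _ (y b) h1 (by rwa [i2]) (Ne.symm e)
    rw [i2] at this d2
    unfold Cfg at this; omega
  · have d1 := h.desc (y a) (by rwa [i1])
    have d2 := h.desc _ h2
    have := h.pair (y a) _ (by rwa [i1]) h2 e'
    rw [i1] at this d1
    unfold Cfg at this; omega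
  · have d1 := h.desc (y a) (by rwa [i1])
    have d2 := h.desc (y b) (by rwa [i2])
    have := h.pair (y a) (y b) (by rwa [i1]) (by rwa [i2]) e2
    rw [i1, i2] at this
    rw [i1] at d1
    rw [i2] at d2
    unfold Cfg at this; omega

/-- Two atoms whose words agree in a window: in that window, no cycle `(y x, x)` of the first
involution can be such that the partner of `x` under the second one is strictly between. -/
theorem Atomic.no_chain {W U y z : ℤ → ℤ} (hy : Atomic W y) (hz : Atomic U z)
    (iW : W.Injective) (iU : U.Injective) {lo hi : ℤ}
    (h1 : ∀ l, lo < W l → W l < hi → U l = W l) (h2 : ∀ l, lo < U l → U l < hi → U l = W l)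
    (x : ℤ) (a1 : y x < z x) (a2 : z x < x) (a3 : lo < W x) (a4 : W x < W (y x))
    (a5 : W (y x) < hi) : False := by
  induction hn : (W (y x) - W x).toNat using Nat.strong_induction_on generalizing x with
  | _ n ih =>
    have u1 := h1 x a3 (by omega)
    have u2 := h1 (y x) (by omega) a5
    -- The letter `x` precedes the smaller letter `y x` in both words. Since `y x < z x`, only the
    -- alternative with `z (y x)` larger than `x` and placed between the two is possible.
    obtain e | e | ⟨e1, -, -, e2, e3⟩ | e := hz.inversion iU (a := y x) (b := x) (by omega) (by
      omega)
    · omega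
    · omega
    swap
    · omega
    have u3 := h2 (z (y x)) (by omega) (by omega)
    obtain e | ⟨f1, -, -, f2, f3⟩ | e := hy.inversion iW (a := y x) (b := z (y x)) (by omega)
      (by omega)
    · have := congrArg y e
      rw [hy.invol, hy.invol] at this
      omega
    · have i := hz.invol (y x)
      -- The letter `z (y x)` repeats the situation of `x`: its partner under `z` is `y x`, its
      -- partner under `y` is smaller still, and both positions lie strictly inside the previous
      -- interval.
      exact ih _ (by omega) (z (y x)) (by omega) (by omega) (by omega) (by omega) (by omega) rfl
    · rw [hy.invol] at e; omega

/-- With `p = y q`, the old word reads `r … q … p` and the new one `q … r … p`. An involution `z`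
for the new word must account for `r` preceding the smaller `p`. Each way of doing so starts a
forbidden chain, either between `q` and `p` or between `r` and `q` in the old word. -/
theorem Atomic.not_atomic_swap_right {W y z : ℤ → ℤ} (hy : Atomic W y) (iW : W.Injective)
    {r q : ℤ} (h1 : y q < r) (h2 : r < q) (h3 : y q < y r) (hrq : W r < W q)
    (hc : ∀ e, r < e → e < q → ¬ (W r < W e ∧ W e < W q)) :
    ¬ Atomic (fun x => W (Equiv.swap r q x)) z := by
  intro hz
  have iU : (fun x => W (Equiv.swap r q x)).Injective := iW.comp (Equiv.injective _)
  set U : ℤ → ℤ := fun x => W (Equiv.swap r q x) with hU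
  have Ur : U r = W q := by simp [hU]
  have Uq : U q = W r := by simp [hU]
  have Ul : ∀ l, l ≠ r → l ≠ q → U l = W l := fun l a b => by
    simp only [hU, Equiv.swap_apply_of_ne_of_ne a b]
  have key : ∀ l, U l ≠ W r → U l ≠ W q → l ≠ r ∧ l ≠ q ∧ U l = W l := by
    intro l a b
    have c1 : l ≠ r := by rintro rfl; exact b Ur
    have c2 : l ≠ q := by rintro rfl; exact a Uq
    exact ⟨c1, c2, Ul l c1 c2⟩
  have key' : ∀ l, W l ≠ W r → W l ≠ W q → U l = W l := by
    intro l a b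
    exact Ul l (by rintro rfl; exact a rfl) (by rintro rfl; exact b rfl)
  have ip := hy.invol q
  obtain ⟨p, hp⟩ : ∃ p, y q = p := ⟨_, rfl⟩
  rw [hp] at h1 h3 ip
  have hqp : W q < W p := by
    have d := hy.desc p (by omega)
    rw [ip] at d
    have : W q ≠ W p := fun e => by have := iW e; omega
    omega
  have Up : U p = W p := Ul p (by omega) (by omega)
  -- The words differ only at the positions `W r` and `W q`, hence agree strictly between `W q` and
  -- `W p` and strictly between `W r` and `W q`.
  have reg1 : ∀ l, W q < W l → W l < W p → U l = W l := fun l a b =>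
    key' l (by omega) (by omega)
  have reg2 : ∀ l, W q < U l → U l < W p → U l = W l := fun l a b =>
    (key l (by omega) (by omega)).2.2
  have reg3 : ∀ l, W r < W l → W l < W q → U l = W l := fun l a b =>
    key' l (by omega) (by omega)
  have reg4 : ∀ l, W r < U l → U l < W q → U l = W l := fun l a b =>
    (key l (by omega) (by omega)).2.2
  have three : z r = p ∨ (z r < p ∧ U r < U (z r) ∧ U (z r) < U p) ∨
      (r < z p ∧ U r < U (z p) ∧ U (z p) < U p) := by
    have := hz.inversion iU (a := p) (b := r) h1 (by omega)
    omega
  obtain e | ⟨e1, e2, e3⟩ | ⟨e1, e2, e3⟩ := three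
  · have ir := hz.invol r
    have iq := hz.invol q
    obtain f | ⟨f1, f1', -, f2, f3⟩ | f := hz.inversion iU (a := r) (b := q) h2 (by omega)
    · rw [f] at iq; omega
    · obtain ⟨n1, n2, n3⟩ := key (z q) (by omega) (by omega)
      obtain g | g | ⟨g1, -, -, g2, g3⟩ | g :=
        hy.inversion iW (a := z q) (b := r) (by omega) (by omega)
      · omega
      · omega
      swap
      · omega
      · have ii := hy.invol (z q)
        have ne : y (z q) ≠ q := fun c => by rw [c] at ii; omega
        -- This letter exceeds `r` and stands between `r` and `q`, so the cover condition pushes it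
        -- above `q`.
        have gt : q < y (z q) := by
          by_contra hlt
          exact hc _ g1 (by omega) ⟨g2, by omega⟩
        have ux := reg3 _ g2 (by omega)
        obtain k | ⟨k1, -, -, k2, k3⟩ | k :=
          hz.inversion iU (a := z q) (b := y (z q)) (by omega) (by omega)
        · have := congrArg z k
          rw [hz.invol, hz.invol] at this
          omega
        -- Here the roles of `y` and `z` are exchanged: the chain starts from a cycle of `z`.
        · exact hz.no_chain hy iU iW (fun l a b => (reg4 l a b).symm)
            (fun l a b => (reg3 l a b).symm) (y (z q)) (by omega) (by omega) (by omega)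
            (by omega) (by omega)
        · rw [hz.invol] at k; omega
    · omega
  · obtain ⟨n1, n2, n3⟩ := key (z r) (by omega) (by omega)
    have ir := hz.invol r
    obtain g | g | ⟨g1, -, -, g2, g3⟩ | g :=
      hy.inversion iW (a := z r) (b := q) (by omega) (by omega)
    · omega
    · omega
    swap
    · omega
    · have ii := hy.invol (z r)
      have ux := reg1 _ g2 (by omega)
      obtain k | ⟨k1, -, -, k2, k3⟩ | k :=
        hz.inversion iU (a := z r) (b := y (z r)) (by omega) (by omega)
      · have := congrArg z k
        rw [hz.invol, hz.invol] at this
        omega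
      · exact hz.no_chain hy iU iW (fun l a b => (reg2 l a b).symm)
          (fun l a b => (reg1 l a b).symm) (y (z r)) (by omega) (by omega) (by omega)
          (by omega) (by omega)
      · rw [hz.invol] at k; omega
  · obtain ⟨n1, n2, n3⟩ := key (z p) (by omega) (by omega)
    have iz := hz.invol p
    -- Otherwise `q`, with partner `p`, would precede the smaller letter `z p`, and `p` would have
    -- to stand before `z p`, contrary to its position.
    have gt : q < z p := by
      by_contra hlt
      have := hy.inversion iW (a := z p) (b := q) (by omega) (by omega)
      rw [hp] at this
      omega
    obtain k | ⟨k1, -, -, k2, k3⟩ | k :=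
      hy.inversion iW (a := p) (b := z p) (by omega) (by omega)
    · have := congrArg y k
      rw [hy.invol, ip] at this
      omega
    · exact hy.no_chain hz iW iU reg1 reg2 (z p) (by omega) (by omega) (by omega)
        (by omega) (by omega)
    · omega

/-- Reversing both letters and positions exchanges the minima and maxima of cycles and preserves all
the conditions; it turns the right-hand obstruction into the left-hand one. -/
theorem Atomic.neg {W y : ℤ → ℤ} (h : Atomic W y) :
    Atomic (fun x => -W (-x)) (fun x => -y (-x)) where
  invol x := by simp [h.invol]
  desc p hp := by
    have := h.desc (y (-p)) (by rw [h.invol]; omega)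
    rw [h.invol] at this
    simpa using this
  pair p p' hp hp' hne := by
    have := h.pair (y (-p)) (y (-p')) (by rw [h.invol]; omega) (by rw [h.invol]; omega)
      (fun e => hne (by
        have := congrArg y e
        rw [h.invol, h.invol] at this
        omega))
    rw [h.invol, h.invol] at this
    unfold Cfg at *
    simp only [neg_neg]
    omega

theorem Atomic.not_atomic_swap_left {W y z : ℤ → ℤ} (hy : Atomic W y) (iW : W.Injective)
    {p r : ℤ} (h1 : r < y p) (h2 : p < r) (h3 : y r < y p) (hpr : W p < W r)
    (hc : ∀ e, p < e → e < r → ¬ (W p < W e ∧ W e < W r)) :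
    ¬ Atomic (fun x => W (Equiv.swap p r x)) z := by
  intro hz
  have hz' := hz.neg
  refine hy.neg.not_atomic_swap_right (z := fun x => -z (-x)) (r := -r) (q := -p)
    ?_ ?_ ?_ ?_ ?_ ?_ ?_
  · intro a b e
    have := iW (neg_injective e)
    omega
  · simpa using h1
  · simpa using h2
  · simpa using h3
  · simpa using hpr
  · intro e e1 e2 ⟨e3, e4⟩
    simp only [neg_neg] at e3 e4
    exact hc (-e) (by omega) (by omega) ⟨by omega, by omega⟩
  · convert hz' using 3 with x
    simp only [Equiv.swap_apply_def]
    congr 1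
    split_ifs <;> omega

/-! ### Exchanges that produce an atom of the new involution -/

/-- Changing an involution and a word on a finite set of letters only. -/
theorem Atomic.replace {W U y z : ℤ → ℤ} (hy : Atomic W y) (S : Set ℤ)
    (hU : ∀ x ∉ S, U x = W x) (hz : ∀ x ∉ S, z x = y x)  (hyS : ∀ x ∈ S, y x ∈ S) (inv : ∀ x ∈ S,
      z (z x) = x)
    (desc : ∀ p ∈ S, p ≤ z p → U (z p) ≤ U p)
    (pair : ∀ p ∈ S, ∀ p' ∈ S, p ≤ z p → p' ≤ z p' → p ≠ p' → Cfg U p (z p) p' (z p'))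
    (mixed : ∀ e f, e ∉ S → f ∉ S → e ≤ f → W f ≤ W e →
      (∀ q ∈ S, q ≤ y q → Cfg W q (y q) e f) → U e = W e → U f = W f →
      ∀ p ∈ S, p ≤ z p → Cfg U p (z p) e f) :
    Atomic U z := by
  have hyS' : ∀ x ∉ S, y x ∉ S := fun x hx h => hx (by
    have := hyS _ h
    rwa [hy.invol] at this)
  -- Both involutions preserve the complement of `S` and agree there, so an outside cycle enters
  -- only through its two letters and its old placement against the cycles in `S`.
  have mixed' : ∀ e ∉ S, e ≤ y e → ∀ p ∈ S, p ≤ z p → Cfg U p (z p) e (y e) := by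
    intro e he hee
    refine mixed e (y e) he (hyS' e he) hee (hy.desc e hee) (fun q hq hqq => ?_) (hU e he)
      (hU _ (hyS' e he))
    exact hy.pair q e hqq hee (fun h => he (h ▸ hq))
  constructor
  · intro x
    by_cases hx : x ∈ S
    · exact inv x hx
    · rw [hz x hx, hz _ (hyS' x hx), hy.invol]
  · intro x h
    by_cases hx : x ∈ S
    · exact desc x hx h
    · rw [hz x hx] at h ⊢
      rw [hU x hx, hU _ (hyS' x hx)]
      exact hy.desc x h
  · intro p p' hp hp' hne
    by_cases h1 : p ∈ S <;> by_cases h2 : p' ∈ S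
    · exact pair p h1 p' h2 hp hp' hne
    · rw [hz p' h2] at hp' ⊢
      exact mixed' p' h2 hp' p h1 hp
    · rw [hz p h1] at hp ⊢
      exact (mixed' p h1 hp p' h2 hp').symm
    · rw [hz p h1] at hp ⊢
      rw [hz p' h2] at hp' ⊢
      have := hy.pair p p' hp hp' hne
      unfold Cfg at *
      rwa [hU p h1, hU p' h2, hU _ (hyS' p h1), hU _ (hyS' p' h2)]

/-- `U` arises from `W` by exchanging the letters `i < j`, and covers it in the Bruhat order. -/
structure CoverSwap (W U : ℤ → ℤ) (i j : ℤ) : Prop where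
  left : U i = W j
  right : U j = W i
  other : ∀ x, x ≠ i → x ≠ j → U x = W x
  lt : W i < W j
  not_between : ∀ e, i < e → e < j → ¬ (W i < W e ∧ W e < W j)

theorem Atomic.desc_lt {W y : ℤ → ℤ} (h : Atomic W y) (iW : W.Injective) (p : ℤ) (hp : p < y p) :
    W (y p) < W p :=
  (h.desc p hp.le).lt_of_ne fun e => hp.ne' (iW e)

theorem CoverSwap.outside {W U : ℤ → ℤ} {i j : ℤ} (h : CoverSwap W U i j) (iW : W.Injective)
    (e : ℤ) (h1 : i < e) (h2 : e < j) : W e < W i ∨ W j < W e := by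
  have := h.not_between e h1 h2
  have n1 : W e ≠ W i := fun c => h1.ne' (iW c)
  have n2 : W e ≠ W j := fun c => h2.ne (iW c)
  omega

/-- This and the next four lemmas are finite order checks. The letters of `S` have a forced order in
the old word; for a cycle `(e,f)` outside, the new placement follows from the old ones and from the
cover condition on `e` and `f`. -/
theorem Atomic.add_cycle {W U y z : ℤ → ℤ} (hy : Atomic W y) (iW : W.Injective)
    {a b : ℤ} (hab : a < b)
    (ya : y a = a) (yb : y b = b)
    (za : z a = b) (zb : z b = a)
    (hz : ∀ x, x ≠ a → x ≠ b → z x = y x)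
    (H : CoverSwap W U a b) :
    Atomic U z := by
  have P := hy.pair a b (by omega) (by omega) (by omega)
  rw [ya, yb] at P
  refine hy.replace {a, b} ?_ ?_ ?_ ?_ ?_ ?_ ?_
  all_goals simp only [Set.mem_insert_iff, Set.mem_singleton_iff, not_or, forall_eq_or_imp,
    forall_eq, ya, yb, za, zb, true_or, or_true, and_true]
  · rintro x ⟨h1, h2⟩
    exact H.other x (by assumption) (by assumption)
  · rintro x ⟨h1, h2⟩
    exact hz x h1 h2
  · have lt := H.lt
    simp only [H.left, H.right]
    omega
  · unfold Cfg at *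
    have lt := H.lt
    simp only [H.left, H.right]
    omega
  · rintro e f ⟨e1, e2⟩ ⟨f1, f2⟩ ef wef A ue uf
    have Aa := A.1 (by omega)
    have Ab := A.2 (by omega)
    clear A
    unfold Cfg at *
    rw [ue, uf]
    have ce := H.outside iW e
    have cf := H.outside iW f
    simp only [H.left, H.right]
    clear hy iW hz ue uf
    grind

/-- The forced order is `b a c`. The exchanges give `c a b` and `b c a`, both with `c` before `a`
and `b` outside. -/
theorem Atomic.extend_cycle_right {W U y z : ℤ → ℤ} (hy : Atomic W y) (iW : W.Injective)
    {a b c : ℤ} (hab : a < b) (hbc : b < c)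
    (ya : y a = b) (yc : y c = c)
    (za : z a = c) (zb : z b = b) (zc : z c = a)
    (hz : ∀ x, x ≠ a → x ≠ b → x ≠ c → z x = y x)
    (H : CoverSwap W U b c ∨ CoverSwap W U a c) :
    Atomic U z := by
  have yb : y b = a := by rw [← ya, hy.invol]
  have P := hy.pair a c (by omega) (by omega) (by omega)
  rw [ya, yc] at P
  have da := hy.desc_lt iW a (by omega)
  rw [ya] at da
  refine hy.replace {a, b, c} ?_ ?_ ?_ ?_ ?_ ?_ ?_
  all_goals simp only [Set.mem_insert_iff, Set.mem_singleton_iff, not_or, forall_eq_or_imp,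
    forall_eq, ya, yb, yc, za, zb, zc, true_or, or_true, and_true]
  · rintro x ⟨h1, h2, h3⟩
    rcases H with H | H <;> exact H.other x (by assumption) (by assumption)
  · rintro x ⟨h1, h2, h3⟩
    exact hz x h1 h2 h3
  · rcases H with H | H
    · have lt := H.lt
      simp only [H.left, H.right, H.other a (by omega) (by omega)]
      omega
    · have lt := H.lt
      have cb := H.outside iW b (by omega) (by omega)
      simp only [H.left, H.right, H.other b (by omega) (by omega)]
      omega
  · unfold Cfg at *
    rcases H with H | H
    · have lt := H.lt
      simp only [H.left, H.right, H.other a (by omega) (by omega)]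
      omega
    · have lt := H.lt
      have cb := H.outside iW b (by omega) (by omega)
      simp only [H.left, H.right, H.other b (by omega) (by omega)]
      omega
  · rintro e f ⟨e1, e2, e3⟩ ⟨f1, f2, f3⟩ ef wef A ue uf
    have Aa := A.1 (by omega)
    have Ac := A.2.2 (by omega)
    clear A
    unfold Cfg at *
    rw [ue, uf]
    rcases H with H | H
    · have ce := H.outside iW e
      have cf := H.outside iW f
      simp only [H.left, H.right, H.other a (by omega) (by omega)]
      clear hy iW hz ue uf
      grind
    · have ce := H.outside iW e
      have cf := H.outside iW f
      simp only [H.left, H.right, H.other b (by omega) (by omega)]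
      clear hy iW hz ue uf
      grind

theorem Atomic.extend_cycle_left {W U y z : ℤ → ℤ} (hy : Atomic W y) (iW : W.Injective)
    {a b c : ℤ} (hab : a < b) (hbc : b < c)
    (ya : y a = a) (yb : y b = c)
    (za : z a = c) (zb : z b = b) (zc : z c = a)
    (hz : ∀ x, x ≠ a → x ≠ b → x ≠ c → z x = y x)
    (H : CoverSwap W U a b ∨ CoverSwap W U a c) :
    Atomic U z := by
  have yc : y c = b := by rw [← yb, hy.invol]
  have P := hy.pair a b (by omega) (by omega) (by omega)
  rw [ya, yb] at P
  have db := hy.desc_lt iW b (by omega)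
  rw [yb] at db
  refine hy.replace {a, b, c} ?_ ?_ ?_ ?_ ?_ ?_ ?_
  all_goals simp only [Set.mem_insert_iff, Set.mem_singleton_iff, not_or, forall_eq_or_imp,
    forall_eq, ya, yb, yc, za, zb, zc, true_or, or_true, and_true]
  · rintro x ⟨h1, h2, h3⟩
    rcases H with H | H <;> exact H.other x (by assumption) (by assumption)
  · rintro x ⟨h1, h2, h3⟩
    exact hz x h1 h2 h3
  · rcases H with H | H
    · have lt := H.lt
      simp only [H.left, H.right, H.other c (by omega) (by omega)]
      omega
    · have lt := H.lt
      have cb := H.outside iW b (by omega) (by omega)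
      simp only [H.left, H.right, H.other b (by omega) (by omega)]
      omega
  · unfold Cfg at *
    rcases H with H | H
    · have lt := H.lt
      simp only [H.left, H.right, H.other c (by omega) (by omega)]
      omega
    · have lt := H.lt
      have cb := H.outside iW b (by omega) (by omega)
      simp only [H.left, H.right, H.other b (by omega) (by omega)]
      omega
  · rintro e f ⟨e1, e2, e3⟩ ⟨f1, f2, f3⟩ ef wef A ue uf
    have Aa := A.1 (by omega)
    have Ab := A.2.1 (by omega)
    clear A
    unfold Cfg at *
    rw [ue, uf]
    rcases H with H | H
    · have ce := H.outside iW e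
      have cf := H.outside iW f
      simp only [H.left, H.right, H.other c (by omega) (by omega)]
      clear hy iW hz ue uf
      grind
    · have ce := H.outside iW e
      have cf := H.outside iW f
      simp only [H.left, H.right, H.other b (by omega) (by omega)]
      clear hy iW hz ue uf
      grind

/-- The forced order `b a d c` becomes `c a d b`, the order required of the crossing cycles. -/
theorem Atomic.cross_cycles {W U y z : ℤ → ℤ} (hy : Atomic W y) (iW : W.Injective)
    {a b c d : ℤ} (hab : a < b) (hbc : b < c) (hcd : c < d)
    (ya : y a = b) (yc : y c = d)
    (za : z a = c) (zb : z b = d) (zc : z c = a) (zd : z d = b)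
    (hz : ∀ x, x ≠ a → x ≠ b → x ≠ c → x ≠ d → z x = y x)
    (H : CoverSwap W U b c) :
    Atomic U z := by
  have yb : y b = a := by rw [← ya, hy.invol]
  have yd : y d = c := by rw [← yc, hy.invol]
  have P := hy.pair a c (by omega) (by omega) (by omega)
  rw [ya, yc] at P
  have da := hy.desc_lt iW a (by omega)
  rw [ya] at da
  have dc := hy.desc_lt iW c (by omega)
  rw [yc] at dc
  refine hy.replace {a, b, c, d} ?_ ?_ ?_ ?_ ?_ ?_ ?_
  all_goals simp only [Set.mem_insert_iff, Set.mem_singleton_iff, not_or, forall_eq_or_imp,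
    forall_eq, ya, yb, yc, yd, za, zb, zc, zd, true_or, or_true, and_true]
  · rintro x ⟨h1, h2, h3, h4⟩
    exact H.other x (by assumption) (by assumption)
  · rintro x ⟨h1, h2, h3, h4⟩
    exact hz x h1 h2 h3 h4
  · have lt := H.lt
    simp only [H.left, H.right, H.other a (by omega) (by omega), H.other d (by omega) (by omega)]
    omega
  · unfold Cfg at *
    have lt := H.lt
    simp only [H.left, H.right, H.other a (by omega) (by omega), H.other d (by omega) (by omega)]
    omega
  · rintro e f ⟨e1, e2, e3, e4⟩ ⟨f1, f2, f3, f4⟩ ef wef A ue uf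
    have Aa := A.1 (by omega)
    have Ac := A.2.2.1 (by omega)
    clear A
    unfold Cfg at *
    rw [ue, uf]
    have ce := H.outside iW e
    have cf := H.outside iW f
    simp only [H.left, H.right, H.other a (by omega) (by omega), H.other d (by omega) (by omega)]
    clear hy iW hz ue uf
    grind

/-- From `b a d c` the three exchanges give `b c d a`, `d a b c` and `b d a c`: always `d` before
`a`, nothing of `b, c` between them, and `b` before `c`. -/
theorem Atomic.merge_cycles {W U y z : ℤ → ℤ} (hy : Atomic W y) (iW : W.Injective)
    {a b c d : ℤ} (hab : a < b) (hbc : b < c) (hcd : c < d)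
    (ya : y a = b) (yc : y c = d)
    (za : z a = d) (zb : z b = b) (zc : z c = c) (zd : z d = a)
    (hz : ∀ x, x ≠ a → x ≠ b → x ≠ c → x ≠ d → z x = y x)
    (H : CoverSwap W U a c ∨ CoverSwap W U b d ∨ CoverSwap W U a d) :
    Atomic U z := by
  have yb : y b = a := by rw [← ya, hy.invol]
  have yd : y d = c := by rw [← yc, hy.invol]
  have P := hy.pair a c (by omega) (by omega) (by omega)
  rw [ya, yc] at P
  have da := hy.desc_lt iW a (by omega)
  rw [ya] at da
  have dc := hy.desc_lt iW c (by omega)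
  rw [yc] at dc
  refine hy.replace {a, b, c, d} ?_ ?_ ?_ ?_ ?_ ?_ ?_
  all_goals simp only [Set.mem_insert_iff, Set.mem_singleton_iff, not_or, forall_eq_or_imp,
    forall_eq, ya, yb, yc, yd, za, zb, zc, zd, true_or, or_true, and_true]
  · rintro x ⟨h1, h2, h3, h4⟩
    rcases H with H | H | H <;> exact H.other x (by assumption) (by assumption)
  · rintro x ⟨h1, h2, h3, h4⟩
    exact hz x h1 h2 h3 h4
  · rcases H with H | H | H
    · have lt := H.lt
      have cb := H.outside iW b (by omega) (by omega)
      simp only [H.left, H.right, H.other b (by omega) (by omega), H.other d (by omega) (by omega)]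
      omega
    · have lt := H.lt
      have cc := H.outside iW c (by omega) (by omega)
      simp only [H.left, H.right, H.other a (by omega) (by omega), H.other c (by omega) (by omega)]
      omega
    · have lt := H.lt
      have cb := H.outside iW b (by omega) (by omega)
      have cc := H.outside iW c (by omega) (by omega)
      simp only [H.left, H.right, H.other b (by omega) (by omega), H.other c (by omega) (by omega)]
      omega
  · unfold Cfg at *
    rcases H with H | H | H
    · have lt := H.lt
      have cb := H.outside iW b (by omega) (by omega)
      simp only [H.left, H.right, H.other b (by omega) (by omega), H.other d (by omega) (by omega)]
      omega
    · have lt := H.lt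
      have cc := H.outside iW c (by omega) (by omega)
      simp only [H.left, H.right, H.other a (by omega) (by omega), H.other c (by omega) (by omega)]
      omega
    · have lt := H.lt
      have cb := H.outside iW b (by omega) (by omega)
      have cc := H.outside iW c (by omega) (by omega)
      simp only [H.left, H.right, H.other b (by omega) (by omega), H.other c (by omega) (by omega)]
      omega
  · rintro e f ⟨e1, e2, e3, e4⟩ ⟨f1, f2, f3, f4⟩ ef wef A ue uf
    have Aa := A.1 (by omega)
    have Ac := A.2.2.1 (by omega)
    clear A
    unfold Cfg at *
    rw [ue, uf]
    rcases H with H | H | H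
    · have ce := H.outside iW e
      have cf := H.outside iW f
      simp only [H.left, H.right, H.other b (by omega) (by omega), H.other d (by omega) (by omega)]
      clear hy iW hz ue uf
      grind
    · have ce := H.outside iW e
      have cf := H.outside iW f
      simp only [H.left, H.right, H.other a (by omega) (by omega), H.other c (by omega) (by omega)]
      clear hy iW hz ue uf
      grind
    · have ce := H.outside iW e
      have cf := H.outside iW f
      simp only [H.left, H.right, H.other b (by omega) (by omega), H.other c (by omega) (by omega)]
      clear hy iW hz ue uf
      grind

/-- From `c a d b` the three exchanges give `c b d a`, `d a c b` and `c d a b`: the inner letters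
`c, b` keep this order and avoid the interval from `d` to `a`. -/
theorem Atomic.nest_cycles {W U y z : ℤ → ℤ} (hy : Atomic W y) (iW : W.Injective)
    {a b c d : ℤ} (hab : a < b) (hbc : b < c) (hcd : c < d)
    (ya : y a = c) (yb : y b = d)
    (za : z a = d) (zb : z b = c) (zc : z c = b) (zd : z d = a)
    (hz : ∀ x, x ≠ a → x ≠ b → x ≠ c → x ≠ d → z x = y x)
    (H : CoverSwap W U a b ∨ CoverSwap W U c d ∨ CoverSwap W U a d) :
    Atomic U z := by
  have yc : y c = a := by rw [← ya, hy.invol]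
  have yd : y d = b := by rw [← yb, hy.invol]
  have P := hy.pair a b (by omega) (by omega) (by omega)
  rw [ya, yb] at P
  have da := hy.desc_lt iW a (by omega)
  rw [ya] at da
  have db := hy.desc_lt iW b (by omega)
  rw [yb] at db
  refine hy.replace {a, b, c, d} ?_ ?_ ?_ ?_ ?_ ?_ ?_
  all_goals simp only [Set.mem_insert_iff, Set.mem_singleton_iff, not_or, forall_eq_or_imp,
    forall_eq, ya, yb, yc, yd, za, zb, zc, zd, true_or, or_true, and_true]
  · rintro x ⟨h1, h2, h3, h4⟩
    rcases H with H | H | H <;> exact H.other x (by assumption) (by assumption)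
  · rintro x ⟨h1, h2, h3, h4⟩
    exact hz x h1 h2 h3 h4
  · rcases H with H | H | H
    · have lt := H.lt
      simp only [H.left, H.right, H.other c (by omega) (by omega), H.other d (by omega) (by omega)]
      omega
    · have lt := H.lt
      simp only [H.left, H.right, H.other a (by omega) (by omega), H.other b (by omega) (by omega)]
      omega
    · have lt := H.lt
      have cb := H.outside iW b (by omega) (by omega)
      have cc := H.outside iW c (by omega) (by omega)
      simp only [H.left, H.right, H.other b (by omega) (by omega), H.other c (by omega) (by omega)]
      omega
  · unfold Cfg at *
    rcases H with H | H | H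
    · have lt := H.lt
      simp only [H.left, H.right, H.other c (by omega) (by omega), H.other d (by omega) (by omega)]
      omega
    · have lt := H.lt
      simp only [H.left, H.right, H.other a (by omega) (by omega), H.other b (by omega) (by omega)]
      omega
    · have lt := H.lt
      have cb := H.outside iW b (by omega) (by omega)
      have cc := H.outside iW c (by omega) (by omega)
      simp only [H.left, H.right, H.other b (by omega) (by omega), H.other c (by omega) (by omega)]
      omega
  · rintro e f ⟨e1, e2, e3, e4⟩ ⟨f1, f2, f3, f4⟩ ef wef A ue uf
    have Aa := A.1 (by omega)
    have Ab := A.2.1 (by omega)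
    clear A
    unfold Cfg at *
    rw [ue, uf]
    rcases H with H | H | H
    · have ce := H.outside iW e
      have cf := H.outside iW f
      simp only [H.left, H.right, H.other c (by omega) (by omega), H.other d (by omega) (by omega)]
      clear hy iW hz ue uf
      grind
    · have ce := H.outside iW e
      have cf := H.outside iW f
      simp only [H.left, H.right, H.other a (by omega) (by omega), H.other b (by omega) (by omega)]
      clear hy iW hz ue uf
      grind
    · have ce := H.outside iW e
      have cf := H.outside iW f
      simp only [H.left, H.right, H.other b (by omega) (by omega), H.other c (by omega) (by omega)]
      clear hy iW hz ue uf
      grind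

/-! ### The dichotomy for the covering transformation -/

theorem tr_apply_of_ne {i j x : ℤ} (h1 : x ≠ i) (h2 : x ≠ j) : (tr i j).1 x = x :=
  Equiv.swap_apply_of_ne_of_ne h1 h2

theorem Covers.coverSwap {w : SZ} {i j : ℤ} (hij : i < j) (h : Covers w (w * tr i j)) :
    CoverSwap w.1 (w * tr i j).1 i j where
  left := by rw [mul_apply, tr_apply, if_pos rfl]
  right := by rw [mul_apply, tr_apply, if_neg hij.ne', if_pos rfl]
  other x h1 h2 := by rw [mul_apply, tr_apply, if_neg h1, if_neg h2]
  lt := h.lt hij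
  not_between := h.not_between

set_option linter.unusedSimpArgs false in
set_option maxHeartbeats 1000000 in
/-- Either `τ_{ij}` changes `y`, and then `w (i,j)` is an atom of the result, or `τ_{ij}` fixes `y`,
and then `w (i,j)` is not an atom. -/
theorem tau_dichotomy {w y : SZ} (hA : Atomic w.1 y.1) {i j : ℤ} (hij : i < j)
    (hc : Covers w (w * tr i j)) :
    (tau i j y ≠ y ∧ Atomic (w * tr i j).1 (tau i j y).1) ∨
    (tau i j y = y ∧ ∀ z : SZ, ¬ Atomic (w * tr i j).1 z.1) := by
  have C := hc.coverSwap hij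
  have iW := w.1.injective
  obtain ⟨z, hz⟩ : ∃ z, tau i j y = z := ⟨_, rfl⟩
  rw [hz]
  unfold tau at hz
  dsimp only at hz
  have ip := hA.invol i
  have iq := hA.invol j
  have hpi := hA.desc i
  obtain ⟨p, hp⟩ : ∃ p, y.1 i = p := ⟨_, rfl⟩
  obtain ⟨q, hq⟩ : ∃ q, y.1 j = q := ⟨_, rfl⟩
  rw [hp] at ip hpi
  rw [hq] at iq
  rw [hp, hq] at hz
  -- If `(i,j)` were a cycle of `y`, then `j` would stand before `i`, and exchanging them would not
  -- go up.
  have hpj : p ≠ j := by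
    rintro rfl
    exact absurd C.lt (hpi hij.le).not_gt
  have hqi : q ≠ i := by
    rintro rfl
    exact hpj (by rw [← hp, iq])
  have hpq : p ≠ q := by
    rintro rfl
    exact hij.ne (ip.symm.trans iq)
  split_ifs at hz with h1 h2 h3 h4 h5 h6 h7 h8
  · have d01 : i ≠ j := by omega
    have z0 : z.1 i = j := by
      simp [← hz, tr_apply, hp, hq, ip, iq, d01, d01.symm]
      omega
    have z1 : z.1 j = i := by
      simp [← hz, tr_apply, hp, hq, ip, iq, d01, d01.symm]
      omega
    have off : ∀ x, x ≠ i → x ≠ j → z.1 x = y.1 x := by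
      intro x n0 n1
      simp [← hz, tr_apply_of_ne, n0, n1]
    have ne : z ≠ y := fun e => by rw [e] at z0; omega
    exact Or.inl ⟨ne, hA.add_cycle iW (by omega) (by omega) (by omega) z0 z1 off
        C⟩
  · rcases lt_or_gt_of_ne h2.1 with h | h
    · rw [min_eq_right h.le] at hz
      have d01 : p ≠ i := by omega
      have d02 : p ≠ j := by omega
      have d12 : i ≠ j := by omega
      have z0 : z.1 p = j := by
        simp [← hz, tr_apply, hp, hq, ip, iq, d01, d01.symm, d02, d02.symm, d12, d12.symm]
        omega
      have z1 : z.1 i = i := by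
        simp [← hz, tr_apply, hp, hq, ip, iq, d01, d01.symm, d02, d02.symm, d12, d12.symm]
      have z2 : z.1 j = p := by
        simp [← hz, tr_apply, hp, hq, ip, iq, d01, d01.symm, d02, d02.symm, d12, d12.symm]
      have off : ∀ x, x ≠ p → x ≠ i → x ≠ j → z.1 x = y.1 x := by
        intro x n0 n1 n2
        simp [← hz, tr_apply_of_ne, n0, n1, n2]
      have ne : z ≠ y := fun e => by rw [e] at z0; omega
      exact Or.inl ⟨ne, hA.extend_cycle_right iW (by omega) (by omega) (by omega) (by omega) z0 z1
        z2 off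
          (.inl C)⟩
    · rw [min_eq_left h.le] at hz
      have d01 : i ≠ p := by omega
      have d02 : i ≠ j := by omega
      have d12 : p ≠ j := by omega
      have z0 : z.1 i = j := by
        simp [← hz, tr_apply, hp, hq, ip, iq, d01, d01.symm, d02, d02.symm, d12, d12.symm]
        omega
      have z1 : z.1 p = p := by
        simp [← hz, tr_apply, hp, hq, ip, iq, d01, d01.symm, d02, d02.symm, d12, d12.symm]
      have z2 : z.1 j = i := by
        simp [← hz, tr_apply, hp, hq, ip, iq, d01, d01.symm, d02, d02.symm, d12, d12.symm]
      have off : ∀ x, x ≠ i → x ≠ p → x ≠ j → z.1 x = y.1 x := by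
        intro x n0 n1 n2
        simp [← hz, tr_apply_of_ne, n0, n1, n2]
      have ne : z ≠ y := fun e => by rw [e] at z0; omega
      exact Or.inl ⟨ne, hA.extend_cycle_right iW (by omega) (by omega) (by omega) (by omega) z0 z1
        z2 off
          (.inr C)⟩
  · rcases lt_or_gt_of_ne h3.2.1 with h | h
    · rw [max_eq_left h.le] at hz
      have d01 : i ≠ q := by omega
      have d02 : i ≠ j := by omega
      have d12 : q ≠ j := by omega
      have z0 : z.1 i = j := by
        simp [← hz, tr_apply, hp, hq, ip, iq, d01, d01.symm, d02, d02.symm, d12, d12.symm]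
      have z1 : z.1 q = q := by
        simp [← hz, tr_apply, hp, hq, ip, iq, d01, d01.symm, d02, d02.symm, d12, d12.symm]
      have z2 : z.1 j = i := by
        simp [← hz, tr_apply, hp, hq, ip, iq, d01, d01.symm, d02, d02.symm, d12, d12.symm]
        omega
      have off : ∀ x, x ≠ i → x ≠ q → x ≠ j → z.1 x = y.1 x := by
        intro x n0 n1 n2
        simp [← hz, tr_apply_of_ne, n0, n1, n2]
      have ne : z ≠ y := fun e => by rw [e] at z0; omega
      exact Or.inl ⟨ne, hA.extend_cycle_left iW (by omega) (by omega) (by omega) (by omega) z0 z1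
        z2 off
          (.inr C)⟩
    · rw [max_eq_right h.le] at hz
      have d01 : i ≠ j := by omega
      have d02 : i ≠ q := by omega
      have d12 : j ≠ q := by omega
      have z0 : z.1 i = q := by
        simp [← hz, tr_apply, hp, hq, ip, iq, d01, d01.symm, d02, d02.symm, d12, d12.symm]
      have z1 : z.1 j = j := by
        simp [← hz, tr_apply, hp, hq, ip, iq, d01, d01.symm, d02, d02.symm, d12, d12.symm]
      have z2 : z.1 q = i := by
        simp [← hz, tr_apply, hp, hq, ip, iq, d01, d01.symm, d02, d02.symm, d12, d12.symm]
        omega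
      have off : ∀ x, x ≠ i → x ≠ j → x ≠ q → z.1 x = y.1 x := by
        intro x n0 n1 n2
        simp [← hz, tr_apply_of_ne, n0, n1, n2]
      have ne : z ≠ y := fun e => by rw [e] at z0; omega
      exact Or.inl ⟨ne, hA.extend_cycle_left iW (by omega) (by omega) (by omega) (by omega) z0 z1
        z2 off
          (.inl C)⟩
  · have d01 : p ≠ i := by omega
    have d02 : p ≠ j := by omega
    have d03 : p ≠ q := by omega
    have d12 : i ≠ j := by omega
    have d13 : i ≠ q := by omega
    have d23 : j ≠ q := by omega
    have z0 : z.1 p = j := by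
      simp [← hz, tr_apply, hp, hq, ip, iq, d01, d01.symm, d02, d02.symm, d03, d03.symm, d12,
        d12.symm, d13, d13.symm, d23, d23.symm]
    have z1 : z.1 i = q := by
      simp [← hz, tr_apply, hp, hq, ip, iq, d01, d01.symm, d02, d02.symm, d03, d03.symm, d12,
        d12.symm, d13, d13.symm, d23, d23.symm]
    have z2 : z.1 j = p := by
      simp [← hz, tr_apply, hp, hq, ip, iq, d01, d01.symm, d02, d02.symm, d03, d03.symm, d12,
        d12.symm, d13, d13.symm, d23, d23.symm]
    have z3 : z.1 q = i := by
      simp [← hz, tr_apply, hp, hq, ip, iq, d01, d01.symm, d02, d02.symm, d03, d03.symm, d12,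
        d12.symm, d13, d13.symm, d23, d23.symm]
    have off : ∀ x, x ≠ p → x ≠ i → x ≠ j → x ≠ q → z.1 x = y.1 x := by
      intro x n0 n1 n2 n3
      simp [← hz, tr_apply_of_ne, n0, n1, n2, n3]
    have ne : z ≠ y := fun e => by rw [e] at z0; omega
    exact Or.inl ⟨ne, hA.cross_cycles iW (by omega) (by omega) (by omega) (by omega) (by omega) z0
      z1 z2 z3 off
        C⟩
  · rcases lt_or_gt_of_ne h5.1 with h | h
    · have h' : q < j := by omega
      rw [min_eq_right h.le, max_eq_left h'.le] at hz
      have d01 : p ≠ i := by omega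
      have d02 : p ≠ q := by omega
      have d03 : p ≠ j := by omega
      have d12 : i ≠ q := by omega
      have d13 : i ≠ j := by omega
      have d23 : q ≠ j := by omega
      have z0 : z.1 p = j := by
        simp [← hz, tr_apply, hp, hq, ip, iq, d01, d01.symm, d02, d02.symm, d03, d03.symm, d12,
          d12.symm, d13, d13.symm, d23, d23.symm]
      have z1 : z.1 i = i := by
        simp [← hz, tr_apply, hp, hq, ip, iq, d01, d01.symm, d02, d02.symm, d03, d03.symm, d12,
          d12.symm, d13, d13.symm, d23, d23.symm]
      have z2 : z.1 q = q := by
        simp [← hz, tr_apply, hp, hq, ip, iq, d01, d01.symm, d02, d02.symm, d03, d03.symm, d12,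
          d12.symm, d13, d13.symm, d23, d23.symm]
      have z3 : z.1 j = p := by
        simp [← hz, tr_apply, hp, hq, ip, iq, d01, d01.symm, d02, d02.symm, d03, d03.symm, d12,
          d12.symm, d13, d13.symm, d23, d23.symm]
      have off : ∀ x, x ≠ p → x ≠ i → x ≠ q → x ≠ j → z.1 x = y.1 x := by
        intro x n0 n1 n2 n3
        simp [← hz, tr_apply_of_ne, n0, n1, n2, n3]
      have ne : z ≠ y := fun e => by rw [e] at z0; omega
      exact Or.inl ⟨ne, hA.merge_cycles iW (by omega) (by omega) (by omega) (by omega) (by omega)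
        z0 z1 z2 z3 off
          (.inr (.inl C))⟩
    · rcases lt_or_gt_of_ne h5.2.1 with h' | h'
      · rw [min_eq_left h.le, max_eq_left h'.le] at hz
        have d01 : i ≠ p := by omega
        have d02 : i ≠ q := by omega
        have d03 : i ≠ j := by omega
        have d12 : p ≠ q := by omega
        have d13 : p ≠ j := by omega
        have d23 : q ≠ j := by omega
        have z0 : z.1 i = j := by
          simp [← hz, tr_apply, hp, hq, ip, iq, d01, d01.symm, d02, d02.symm, d03, d03.symm, d12,
            d12.symm, d13, d13.symm, d23, d23.symm]
        have z1 : z.1 p = p := by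
          simp [← hz, tr_apply, hp, hq, ip, iq, d01, d01.symm, d02, d02.symm, d03, d03.symm, d12,
            d12.symm, d13, d13.symm, d23, d23.symm]
        have z2 : z.1 q = q := by
          simp [← hz, tr_apply, hp, hq, ip, iq, d01, d01.symm, d02, d02.symm, d03, d03.symm, d12,
            d12.symm, d13, d13.symm, d23, d23.symm]
        have z3 : z.1 j = i := by
          simp [← hz, tr_apply, hp, hq, ip, iq, d01, d01.symm, d02, d02.symm, d03, d03.symm, d12,
            d12.symm, d13, d13.symm, d23, d23.symm]
        have off : ∀ x, x ≠ i → x ≠ p → x ≠ q → x ≠ j → z.1 x = y.1 x := by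
          intro x n0 n1 n2 n3
          simp [← hz, tr_apply_of_ne, n0, n1, n2, n3]
        have ne : z ≠ y := fun e => by rw [e] at z0; omega
        exact Or.inl ⟨ne, hA.merge_cycles iW (by omega) (by omega) (by omega) (by omega) (by
          omega) z0 z1 z2 z3 off
            (.inr (.inr C))⟩
      · rw [min_eq_left h.le, max_eq_right h'.le] at hz
        have d01 : i ≠ p := by omega
        have d02 : i ≠ j := by omega
        have d03 : i ≠ q := by omega
        have d12 : p ≠ j := by omega
        have d13 : p ≠ q := by omega
        have d23 : j ≠ q := by omega
        have z0 : z.1 i = q := by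
          simp [← hz, tr_apply, hp, hq, ip, iq, d01, d01.symm, d02, d02.symm, d03, d03.symm, d12,
            d12.symm, d13, d13.symm, d23, d23.symm]
        have z1 : z.1 p = p := by
          simp [← hz, tr_apply, hp, hq, ip, iq, d01, d01.symm, d02, d02.symm, d03, d03.symm, d12,
            d12.symm, d13, d13.symm, d23, d23.symm]
        have z2 : z.1 j = j := by
          simp [← hz, tr_apply, hp, hq, ip, iq, d01, d01.symm, d02, d02.symm, d03, d03.symm, d12,
            d12.symm, d13, d13.symm, d23, d23.symm]
        have z3 : z.1 q = i := by
          simp [← hz, tr_apply, hp, hq, ip, iq, d01, d01.symm, d02, d02.symm, d03, d03.symm, d12,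
            d12.symm, d13, d13.symm, d23, d23.symm]
        have off : ∀ x, x ≠ i → x ≠ p → x ≠ j → x ≠ q → z.1 x = y.1 x := by
          intro x n0 n1 n2 n3
          simp [← hz, tr_apply_of_ne, n0, n1, n2, n3]
        have ne : z ≠ y := fun e => by rw [e] at z0; omega
        exact Or.inl ⟨ne, hA.merge_cycles iW (by omega) (by omega) (by omega) (by omega) (by
          omega) z0 z1 z2 z3 off
            (.inl C)⟩
  · have d01 : i ≠ j := by omega
    have d02 : i ≠ p := by omega
    have d03 : i ≠ q := by omega
    have d12 : j ≠ p := by omega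
    have d13 : j ≠ q := by omega
    have d23 : p ≠ q := by omega
    have z0 : z.1 i = q := by
      simp [← hz, tr_apply, hp, hq, ip, iq, d01, d01.symm, d02, d02.symm, d03, d03.symm, d12,
        d12.symm, d13, d13.symm, d23, d23.symm]
    have z1 : z.1 j = p := by
      simp [← hz, tr_apply, hp, hq, ip, iq, d01, d01.symm, d02, d02.symm, d03, d03.symm, d12,
        d12.symm, d13, d13.symm, d23, d23.symm]
    have z2 : z.1 p = j := by
      simp [← hz, tr_apply, hp, hq, ip, iq, d01, d01.symm, d02, d02.symm, d03, d03.symm, d12,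
        d12.symm, d13, d13.symm, d23, d23.symm]
    have z3 : z.1 q = i := by
      simp [← hz, tr_apply, hp, hq, ip, iq, d01, d01.symm, d02, d02.symm, d03, d03.symm, d12,
        d12.symm, d13, d13.symm, d23, d23.symm]
    have off : ∀ x, x ≠ i → x ≠ j → x ≠ p → x ≠ q → z.1 x = y.1 x := by
      intro x n0 n1 n2 n3
      simp [← hz, tr_apply_of_ne, n0, n1, n2, n3]
    have ne : z ≠ y := fun e => by rw [e] at z0; omega
    exact Or.inl ⟨ne, hA.nest_cycles iW (by omega) (by omega) (by omega) (by omega) (by omega) z0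
      z1 z2 z3 off
        (.inl C)⟩
  · have d01 : p ≠ q := by omega
    have d02 : p ≠ i := by omega
    have d03 : p ≠ j := by omega
    have d12 : q ≠ i := by omega
    have d13 : q ≠ j := by omega
    have d23 : i ≠ j := by omega
    have z0 : z.1 p = j := by
      simp [← hz, tr_apply, hp, hq, ip, iq, d01, d01.symm, d02, d02.symm, d03, d03.symm, d12,
        d12.symm, d13, d13.symm, d23, d23.symm]
    have z1 : z.1 q = i := by
      simp [← hz, tr_apply, hp, hq, ip, iq, d01, d01.symm, d02, d02.symm, d03, d03.symm, d12,
        d12.symm, d13, d13.symm, d23, d23.symm]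
    have z2 : z.1 i = q := by
      simp [← hz, tr_apply, hp, hq, ip, iq, d01, d01.symm, d02, d02.symm, d03, d03.symm, d12,
        d12.symm, d13, d13.symm, d23, d23.symm]
    have z3 : z.1 j = p := by
      simp [← hz, tr_apply, hp, hq, ip, iq, d01, d01.symm, d02, d02.symm, d03, d03.symm, d12,
        d12.symm, d13, d13.symm, d23, d23.symm]
    have off : ∀ x, x ≠ p → x ≠ q → x ≠ i → x ≠ j → z.1 x = y.1 x := by
      intro x n0 n1 n2 n3
      simp [← hz, tr_apply_of_ne, n0, n1, n2, n3]
    have ne : z ≠ y := fun e => by rw [e] at z0; omega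
    exact Or.inl ⟨ne, hA.nest_cycles iW (by omega) (by omega) (by omega) (by omega) (by omega) z0
      z1 z2 z3 off
        (.inr (.inl C))⟩
  · have d01 : i ≠ q := by omega
    have d02 : i ≠ p := by omega
    have d03 : i ≠ j := by omega
    have d12 : q ≠ p := by omega
    have d13 : q ≠ j := by omega
    have d23 : p ≠ j := by omega
    have z0 : z.1 i = j := by
      simp [← hz, tr_apply, hp, hq, ip, iq, d01, d01.symm, d02, d02.symm, d03, d03.symm, d12,
        d12.symm, d13, d13.symm, d23, d23.symm]
    have z1 : z.1 q = p := by
      simp [← hz, tr_apply, hp, hq, ip, iq, d01, d01.symm, d02, d02.symm, d03, d03.symm, d12,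
        d12.symm, d13, d13.symm, d23, d23.symm]
    have z2 : z.1 p = q := by
      simp [← hz, tr_apply, hp, hq, ip, iq, d01, d01.symm, d02, d02.symm, d03, d03.symm, d12,
        d12.symm, d13, d13.symm, d23, d23.symm]
    have z3 : z.1 j = i := by
      simp [← hz, tr_apply, hp, hq, ip, iq, d01, d01.symm, d02, d02.symm, d03, d03.symm, d12,
        d12.symm, d13, d13.symm, d23, d23.symm]
    have off : ∀ x, x ≠ i → x ≠ q → x ≠ p → x ≠ j → z.1 x = y.1 x := by
      intro x n0 n1 n2 n3
      simp [← hz, tr_apply_of_ne, n0, n1, n2, n3]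
    have ne : z ≠ y := fun e => by rw [e] at z0; omega
    exact Or.inl ⟨ne, hA.nest_cycles iW (by omega) (by omega) (by omega) (by omega) (by omega) z0
      z1 z2 z3 off
        (.inr (.inr C))⟩
  · refine Or.inr ⟨hz.symm, fun z hz => ?_⟩
    -- What remains when `τ_{ij}` fixes `y`: either `i` lies between `y j` and `j`, or `j` lies
    -- between `i` and `y i`, in both cases with `y j < y i`. These are the hypotheses of the two
    -- obstructions.
    have hcase : (q < i ∧ q < p) ∨ (j < p ∧ q < p) := by omega
    rcases hcase with h | h
    · exact hA.not_atomic_swap_right iW (by omega) hij (by omega) C.lt C.not_between hz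
    · exact hA.not_atomic_swap_left iW (by omega) hij (by omega) C.lt C.not_between hz

end InvolutionAtoms

/-! ### Proof of the theorem -/

open InvolutionAtoms
theorem theorem3 :
    -- the two statements about the covering transformations
    (∀ y ∈ IZ, ∀ w ∈ atoms y, ∀ i j : ℤ, i < j → Covers w (w * tr i j) →
      (∀ z ∈ IZ, w * tr i j ∈ atoms z → z = tau i j y ∧ tau i j y ≠ y) ∧
      ((∀ z ∈ IZ, w * tr i j ∉ atoms z) → tau i j y = y)) ∧
    -- at most one involution has an atom that covers an atom of `y` through `t = (i,j)`
    (∀ i j : ℤ, i < j → ∀ y ∈ IZ,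
      {z : SZ | z ∈ IZ ∧ ∃ w ∈ atoms y, Covers w (w * tr i j) ∧
        w * tr i j ∈ atoms z}.Subsingleton) ∧
    -- there is at most one involution `z` with `∅ ≠ {w t : w t ⋖ w ∈ A(z)} ⊆ A(y)`
    (∀ i j : ℤ, i < j → ∀ y ∈ IZ,
      {z : SZ | z ∈ IZ ∧
        {v : SZ | ∃ w ∈ atoms z, v = w * tr i j ∧ Covers v w}.Nonempty ∧
        {v : SZ | ∃ w ∈ atoms z, v = w * tr i j ∧ Covers v w} ⊆ atoms y}.Subsingleton) := by
  have main : ∀ y, ∀ w ∈ atoms y, ∀ i j : ℤ, i < j → Covers w (w * tr i j) →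
      (∀ z ∈ IZ, w * tr i j ∈ atoms z → z = tau i j y ∧ tau i j y ≠ y) ∧
      ((∀ z ∈ IZ, w * tr i j ∉ atoms z) → tau i j y = y) := by
    intro y w hw i j hij hc
    rcases tau_dichotomy (mem_atoms_iff.1 hw) hij hc with ⟨h1, h2⟩ | ⟨h1, h2⟩
    · have h3 := mem_atoms_iff.2 h2
      -- Both involutions equal the Demazure product of the inverse of the word with the word
      -- itself, hence coincide.
      exact ⟨fun z _ hz => ⟨hz.1.trans h3.1.symm, h1⟩, fun h => absurd h3 (h _ (mem_IZ h2.invol))⟩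
    · exact ⟨fun z _ hz => absurd (mem_atoms_iff.1 hz) (h2 z), fun _ => h1⟩
  refine ⟨fun y _ => main y, ?_, ?_⟩
  · rintro i j hij y - z ⟨hz, w, hw, hc, hwz⟩ z' ⟨hz', w', hw', hc', hwz'⟩
    rw [((main y w hw i j hij hc).1 z hz hwz).1, ((main y w' hw' i j hij hc').1 z' hz' hwz').1]
  · have key : ∀ i j : ℤ, i < j → ∀ y z : SZ, z ∈ IZ →
        {v : SZ | ∃ w ∈ atoms z, v = w * tr i j ∧ Covers v w}.Nonempty →
        {v : SZ | ∃ w ∈ atoms z, v = w * tr i j ∧ Covers v w} ⊆ atoms y → z = tau i j y := by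
      rintro i j hij y z hz ⟨v, w, hw, rfl, hc⟩ hsub
      -- The lower element `w t` is an atom of `y`, and multiplying it by `t` returns `w`, so the
      -- first statement applies with `w t` in place of `w`.
      have hv : w * tr i j ∈ atoms y := hsub ⟨w, hw, rfl, hc⟩
      have e : w * tr i j * tr i j = w := by rw [mul_assoc, tr_mul_self, mul_one]
      exact ((main y _ hv i j hij (by rwa [e])).1 z hz (by rwa [e])).1
    rintro i j hij y - z ⟨hz, hn, hs⟩ z' ⟨hz', hn', hs'⟩
    rw [key i j hij y z hz hn hs, key i j hij y z' hz' hn' hs']
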